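/- Let $d\ge 3$. Let $g(x,y)=\sum_{n\ge 0}P_x[X_n=y]$ be the Green function of simple random walk on $\mathbb{Z}^d$, and let $\mathbb{P}$ be the law on $\mathbb{R}^{\mathbb{Z}^d}$ of the Gaussian free field, i.e. under $\mathbb{P}$ the canonical field $\varphi=(\varphi_x)_{x\in\mathbb{Z}^d}$ is centered Gaussian with covariance $\mathbb{E}[\varphi_x\varphi_y]=g(x,y)$. Let $\Omega=\{0,1\}^{\mathbb{Z}^d}$ with canonical coordinates $Y_z$ and the coordinatewise partial order, and for $h\in\mathbb{R}$ let $\Phi^h:\mathbb{R}^{\mathbb{Z}^d}\to\Omega$, $\Phi^h(\varphi)=(1\{\varphi_x\ge h\})_{x\in\mathbb{Z}^d}$. All distances $d(\cdot,\cdot)$ below are $\ell^\infty$-distances. For integers $L_0\ge 1$, $l_0\ge 100$ and $n\ge 0$ put $L_n=l_0^nL_0$, $\mathbb{L}_n=L_n\mathbb{Z}^d$, $\mathcal{I}_n=\{n\}\times\mathbb{L}_n$, and for $x\in\mathbb{L}_n$ put $B_{n,x}=x+([0,L_n)\cap\mathbb{Z})^d$ and $\widetilde B_{n,x}=\bigcup_{y\in\mathbb{L}_n:\,d(B_{n,y},B_{n,x})\le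 1}B_{n,y}$. For $n\ge 1$ and $x\in\mathbb{L}_n$ let $$\mathcal{H}_1(n,x)=\{(n-1,y)\in\mathcal{I}_{n-1}: B_{n-1,y}\subset B_{n,x},\ B_{n-1,y}\cap\partial^iB_{n,x}\ne\emptyset\},$$ $$\mathcal{H}_2(n,x)=\{(n-1,y)\in\mathcal{I}_{n-1}: B_{n-1,y}\cap\{z\in\mathbb{Z}^d: d(z,B_{n,x})=\lfloor L_n/2\rfloor\}\ne\emptyset\},$$ where $\partial^iK$ is the set of points of $K$ having a nearest neighbor outside $K$. For $n\ge 0$ and $x\in\mathbb{L}_n$ let $\Lambda_{n,x}$ be the family of (dyadic trees) $\mathcal{T}\subset\bigcup_{k=0}^n\mathcal{I}_k$ such that $\mathcal{T}\cap\mathcal{I}_n=\{(n,x)\}$ and every $(k,y)\in\mathcal{T}\cap\mathcal{I}_k$, $0<k\le n$, has two descendants $(k-1,y_i(k,y))\in\mathcal{H}_i(k,y)$, $i=1,2$, with $\mathcal{T}\cap\mathcal{I}_{k-1}=\bigcup_{(k,y)\in\mathcal{T}\cap\mathcal{I}_k}\{(k-1,y_1(k,y)),(k-1,y_2(k,y))\}$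 for all $0<k\le n$. Given events $D_x\subset\Omega$, $x\in\mathbb{L}_0$, define $$D_{\mathcal{T}}^h=\bigcap_{(0,y)\in\mathcal{T}\cap\mathcal{I}_0}(\Phi^h)^{-1}(D_y),\qquad q_n(h)=\sup_{x\in\mathbb{L}_n,\ \mathcal{T}\in\Lambda_{n,x}}\mathbb{P}[D^h_{\mathcal{T}}].$$ Then there are constants $c_1,c_2>0$ depending only on $d$ such that, with $M(n,L_0)=c_2\big(\log(2^n(3L_0)^d)\big)^{1/2}$, the following holds for all integers $L_0\ge 1$, $l_0\ge 100$ and every collection of events $D_x$, $x\in\mathbb{L}_0$, such that $D_x$ is $\sigma(Y_z: z\in\widetilde B_{0,x})$-measurable for each $x\in\mathbb{L}_0$. (i) If every $D_x$ is increasing, $(\beta_n)_{n\ge 0}$ is a positive sequence and $(h_n)_{n\ge 0}$ a real increasing sequence such that for all $n\ge 0$ $$\beta_n\ge(\log 2)^{1/2}+M(n,L_0)\quad(2.9),\qquad h_{n+1}\ge h_n+c_1\beta_n\big(2l_0^{-(d-2)}\big)^{n+1}\quad(2.10),$$ then $$q_{n+1}(h_{n+1})\le q_n(h_n)^2+3e^{-(\beta_n-M(n,L_0))^2}\qquad\text{for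 all } n\ge 0.\quad(*)$$ (ii) If every $D_x$ is decreasing, $(\beta_n)_{n\ge 0}$ is a positive sequence and $(h_n)_{n\ge 0}$ a real decreasing sequence such that (2.9) holds and (2.10) holds for $(-h_n)_{n\ge 0}$ in place of $(h_n)_{n\ge0}$, then $(*)$ holds as well. -/

import Mathlib

open MeasureTheory ProbabilityTheory Set

namespace GFF

/-- The lattice `ℤ^d`. Its `dist` (product metric) is the `ℓ^∞`-distance. -/
abbrev Lat (d : ℕ) : Type := Fin d → ℤ

/-- The space `{0,1}^{ℤ^d}`, with the product σ-algebra and the coordinatewise order. -/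
abbrev Config (d : ℕ) : Type := Lat d → Bool

noncomputable section

/-! ### Simple random walk, Green function, Gaussian free field -/

/-- `P_x[X_n = y]` for the discrete-time simple random walk on `ℤ^d`
(decomposition according to the first of the `n` steps). -/
def srwProb (d : ℕ) : ℕ → Lat d → Lat d → ℝ
  | 0, x, y => if x = y then 1 else 0
  | n + 1, x, y =>
      (1 / (2 * (d : ℝ))) *
        ∑ i : Fin d, (srwProb d n (x + Pi.single i 1) y + srwProb d n (x - Pi.single i 1) y)

/-- The Green function `g(x,y) = ∑_{n ≥ 0} P_x[X_n = y]` (a convergent series when `d ≥ 3`). -/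
def green (d : ℕ) (x y : Lat d) : ℝ := ∑' n : ℕ, srwProb d n x y

/-- `P` is the canonical law of the Gaussian free field on `ℤ^d`: under `P` the canonical
coordinates form a centered Gaussian field with covariance the Green function. -/
structure IsGFF (d : ℕ) (P : Measure (Lat d → ℝ)) : Prop where
  isProbabilityMeasure : IsProbabilityMeasure P
  isGaussianProcess : IsGaussianProcess (fun (x : Lat d) (φ : Lat d → ℝ) => φ x) P
  mean : ∀ x : Lat d, ∫ φ, φ x ∂P = 0
  covariance : ∀ x y : Lat d, ∫ φ, φ x * φ y ∂P = green d x y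

/-! ### Lattice geometry -/

/-- Nearest neighbors: Euclidean distance one. -/
def Neighbor {d : ℕ} (x y : Lat d) : Prop := ∑ i : Fin d, (y i - x i) ^ 2 = 1

/-- The inner boundary `∂^i K`. -/
def innerBoundary {d : ℕ} (K : Set (Lat d)) : Set (Lat d) :=
  {x | x ∈ K ∧ ∃ y, y ∉ K ∧ Neighbor x y}

/-- The `ℓ^∞`-distance between two (non-empty) sets. -/
def setDist {d : ℕ} (K U : Set (Lat d)) : ℝ :=
  sInf {r : ℝ | ∃ x ∈ K, ∃ y ∈ U, r = dist x y}

/-- The length scales `L_n = l_0^n L_0`. -/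
def scale (L₀ l₀ n : ℕ) : ℕ := l₀ ^ n * L₀

/-- The renormalized lattice `L_n ℤ^d`. -/
def renLat (d L₀ l₀ n : ℕ) : Set (Lat d) := {x | ∀ i, (scale L₀ l₀ n : ℤ) ∣ x i}

/-- The box `B_{n,x} = x + ([0, L_n) ∩ ℤ)^d`. -/
def box {d : ℕ} (L₀ l₀ n : ℕ) (x : Lat d) : Set (Lat d) :=
  {y | ∀ i, x i ≤ y i ∧ y i < x i + (scale L₀ l₀ n : ℤ)}

/-- The union of the boxes `B_{n,y}`, `y ∈ L_n ℤ^d`, at distance at most one from `B_{n,x}`. -/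
def bigBox {d : ℕ} (L₀ l₀ n : ℕ) (x : Lat d) : Set (Lat d) :=
  ⋃ y ∈ {y : Lat d | y ∈ renLat d L₀ l₀ n ∧ setDist (box L₀ l₀ n y) (box L₀ l₀ n x) ≤ 1},
    box L₀ l₀ n y

/-! ### Dyadic trees -/

/-- The labels `I_n = {n} × L_n ℤ^d`. -/
def labels (d L₀ l₀ n : ℕ) : Set (ℕ × Lat d) := {p | p.1 = n ∧ p.2 ∈ renLat d L₀ l₀ n}

/-- The first set of possible descendants of the label `(k + 1, x)`. -/
def desc₁ {d : ℕ} (L₀ l₀ k : ℕ) (x : Lat d) : Set (ℕ × Lat d) :=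
  {p | p ∈ labels d L₀ l₀ k ∧ box L₀ l₀ k p.2 ⊆ box L₀ l₀ (k + 1) x ∧
    (box L₀ l₀ k p.2 ∩ innerBoundary (box L₀ l₀ (k + 1) x)).Nonempty}

/-- The second set of possible descendants of the label `(k + 1, x)`; the division by two
is that of natural numbers, i.e. the integer part. -/
def desc₂ {d : ℕ} (L₀ l₀ k : ℕ) (x : Lat d) : Set (ℕ × Lat d) :=
  {p | p ∈ labels d L₀ l₀ k ∧
    (box L₀ l₀ k p.2 ∩
      {z | setDist {z} (box L₀ l₀ (k + 1) x) = ((scale L₀ l₀ (k + 1) / 2 : ℕ) : ℝ)}).Nonempty}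

/-- The family `Λ_{n,x}` of dyadic trees of depth `n` with root `(n,x)`. -/
def trees {d : ℕ} (L₀ l₀ n : ℕ) (x : Lat d) : Set (Set (ℕ × Lat d)) :=
  {T | T ⊆ (⋃ k ∈ {k : ℕ | k ≤ n}, labels d L₀ l₀ k) ∧
    T ∩ labels d L₀ l₀ n = {(n, x)} ∧
    ∃ y₁ y₂ : ℕ → Lat d → Lat d, ∀ k < n,
      (∀ y, (k + 1, y) ∈ T →
        (k, y₁ (k + 1) y) ∈ desc₁ L₀ l₀ k y ∧ (k, y₂ (k + 1) y) ∈ desc₂ L₀ l₀ k y) ∧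
      T ∩ labels d L₀ l₀ k =
        ⋃ y ∈ {y : Lat d | (k + 1, y) ∈ T}, {(k, y₁ (k + 1) y), (k, y₂ (k + 1) y)}}

/-! ### Events -/

/-- The map `Φ^h` sending `φ` to `(1{φ_x ≥ h})_x`. -/
def threshold {d : ℕ} (h : ℝ) (φ : Lat d → ℝ) : Config d := fun x => decide (h ≤ φ x)

/-- The σ-algebra on `{0,1}^{ℤ^d}` generated by the coordinates in `K`. -/
abbrev coordSigma {d : ℕ} (K : Set (Lat d)) : MeasurableSpace (Config d) :=
  ⨆ z ∈ K, MeasurableSpace.comap (fun ω : Config d => ω z) ⊤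

/-- The joint event `D_T^h`, the intersection over the leaves `(0,y)` of `T` of
`(Φ^h)⁻¹(D_y)`. -/
def treeEvent {d : ℕ} (D : Lat d → Set (Config d)) (T : Set (ℕ × Lat d)) (h : ℝ) :
    Set (Lat d → ℝ) :=
  ⋂ y ∈ {y : Lat d | (0, y) ∈ T}, threshold h ⁻¹' D y

/-- `q_n(h)`, the supremum of `P[D_T^h]` over `x ∈ L_n ℤ^d` and `T ∈ Λ_{n,x}`. -/
def q {d : ℕ} (P : Measure (Lat d → ℝ)) (L₀ l₀ : ℕ) (D : Lat d → Set (Config d))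
    (n : ℕ) (h : ℝ) : ℝ :=
  sSup {p : ℝ | ∃ x ∈ renLat d L₀ l₀ n, ∃ T ∈ trees L₀ l₀ n x, p = P.real (treeEvent D T h)}

/-- `M(n, L_0) = c_2 (log (2^n (3 L_0)^d))^{1/2}`. -/
def M (c₂ : ℝ) (d n L₀ : ℕ) : ℝ :=
  c₂ * Real.sqrt (Real.log ((2 : ℝ) ^ n * (3 * (L₀ : ℝ)) ^ d))

/-- `β_n ≥ (log 2)^{1/2} + M(n, L_0)` for all `n ≥ 0`. -/
def BetaCondition (c₂ : ℝ) (d L₀ : ℕ) (β : ℕ → ℝ) : Prop :=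
  ∀ n, Real.sqrt (Real.log 2) + M c₂ d n L₀ ≤ β n

/-- `h_{n+1} ≥ h_n + c_1 β_n (2 l_0^{-(d-2)})^{n+1}` for all `n ≥ 0`. -/
def LevelCondition (c₁ : ℝ) (d l₀ : ℕ) (β h : ℕ → ℝ) : Prop :=
  ∀ n, h n + c₁ * β n * (2 * (l₀ : ℝ) ^ (-((d : ℤ) - 2))) ^ (n + 1) ≤ h (n + 1)

end

end GFF

open MeasureTheory ProbabilityTheory Set

namespace GFF

noncomputable section

/-! ### Decay of the Green function -/

/-! A tree of depth `n + 1` is two trees of depth `n` whose leaves live in far apart unions `K₁`,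
`K₂` of cubes of side `3 * L₀`. Were the field in `K₂` independent of the field in `K₁`, the
probability would factor and give the square of `q` at depth `n`. The proof makes this exact up to a
small perturbation of the field.

For `x ∈ K₂`, let `w x` give the best linear predictor of `φ x` from the values on the shell `S` of
`K₁`. By the maximum principle the residual is uncorrelated with the whole field in `K₁`, hence
independent of it (`IsGFF.residual_orthogonal`, `IsGFF.measureReal_inter_residual`). The predictor
is small: the operator with kernel the Green function inverts `I - P`, where `P` is one step of the
walk, so it is at least `1/2` as a quadratic form (`IsGFF.sum_sq_le`), and Cauchy-Schwarz bounds the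
predictor's variance by `2 * |S| * (max g)²` over `K₂ × S`. The decay of `g` comes from a
superharmonic barrier (`exists_green_le`).

Off a bad event of Gaussian tail probability, field and residual differ by at most `γ`. Passing to
the residual and back costs `2 * γ`, which monotonicity of the events converts into the change of
level from `h (n + 1)` to `h n` (`IsGFF.decoupling`, `IsGFF.q_succ_le`). The bad event is paid for
twice, whence the exponential error. -/

/-- One step of the simple random walk, acting on functions. -/
def stepAvg {d : ℕ} (f : Lat d → ℝ) (x : Lat d) : ℝ :=
  (1 / (2 * (d : ℝ))) * ∑ i : Fin d, (f (x + Pi.single i 1) + f (x - Pi.single i 1))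

lemma stepAvg_mono {d : ℕ} {f g : Lat d → ℝ} (h : ∀ x, f x ≤ g x) (x : Lat d) :
    stepAvg f x ≤ stepAvg g x := by
  unfold stepAvg
  gcongr <;> apply h

lemma stepAvg_const_mul {d : ℕ} (c : ℝ) (f : Lat d → ℝ) (x : Lat d) :
    stepAvg (fun z => c * f z) x = c * stepAvg f x := by
  simp only [stepAvg, ← mul_add, ← Finset.mul_sum]
  ring

lemma stepAvg_add {d : ℕ} (f g : Lat d → ℝ) (x : Lat d) :
    stepAvg (fun z => f z + g z) x = stepAvg f x + stepAvg g x := by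
  simp only [stepAvg, ← mul_add, ← Finset.sum_add_distrib]
  congr 1
  exact Finset.sum_congr rfl fun i _ => by ring

lemma stepAvg_sum {d : ℕ} {ι : Type*} (s : Finset ι) (f : ι → Lat d → ℝ) (x : Lat d) :
    stepAvg (fun z => ∑ j ∈ s, f j z) x = ∑ j ∈ s, stepAvg (f j) x := by
  simp only [stepAvg, ← Finset.mul_sum, ← Finset.sum_add_distrib]
  rw [Finset.sum_comm]

lemma srwProb_succ (d n : ℕ) (x y : Lat d) :
    srwProb d (n + 1) x y = stepAvg (fun z => srwProb d n z y) x := rfl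

lemma srwProb_nonneg (d n : ℕ) (x y : Lat d) : 0 ≤ srwProb d n x y := by
  induction n generalizing x with
  | zero => simp only [srwProb]; split_ifs <;> norm_num
  | succ n ih =>
    rw [srwProb_succ, stepAvg]
    exact mul_nonneg (by positivity)
      (Finset.sum_nonneg fun i _ => add_nonneg (ih _) (ih _))

/-- Third order Taylor expansion of a negative power at `1`. -/
lemma exists_rpow_neg_expansion (s : ℝ) : ∃ C c δ : ℝ, 0 ≤ C ∧ 0 < δ ∧ δ < 1 ∧
    ∀ t : ℝ, |t| ≤ δ →
      (1 + t) ^ (-s) ≤ 1 - s * t + s * (s + 1) / 2 * t ^ 2 + c * t ^ 3 + C * t ^ 4 := by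
  have h := (Real.one_add_rpow_hasFPowerSeriesAt_zero (a := -s)).isBigO_sub_partialSum_pow 4
  simp only [FormalMultilinearSeries.partialSum, Finset.sum_range_succ, Finset.sum_range_zero,
    binomialSeries_apply, zero_add] at h
  -- Only the quadratic coefficient matters exactly: odd orders nearly cancel between opposite
  -- directions.
  have h2 : Ring.choose (-s) 2 = s * (s + 1) / 2 := by
    have := Ring.descPochhammer_eq_factorial_smul_choose (-s) 2
    simp [descPochhammer_succ_right, Polynomial.smeval_mul, Polynomial.smeval_sub,
      Polynomial.smeval_X] at this
    linarith
  obtain ⟨C, hC0, hC⟩ := h.exists_nonneg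
  rw [Asymptotics.isBigOWith_iff, Metric.eventually_nhds_iff] at hC
  obtain ⟨ε, hε, H⟩ := hC
  refine ⟨C, Ring.choose (-s) 3, min (ε / 2) (1 / 2), hC0, by positivity, ?_, fun t ht => ?_⟩
  · exact (min_le_right _ _).trans_lt (by norm_num)
  · have ht' : dist t 0 < ε := by
      rw [dist_zero_right, Real.norm_eq_abs]
      have := ht.trans (min_le_left _ _)
      linarith
    have := H ht'
    simp [h2] at this
    have h3 := (abs_le.1 this).2
    have : |t| ^ 4 = t ^ 4 := by rw [← abs_pow, abs_of_nonneg (by positivity)]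
    rw [this] at h3
    linarith

/-- The squared Euclidean norm. -/
def normSq {d : ℕ} (x : Lat d) : ℝ := ∑ i, (x i : ℝ) ^ 2

lemma normSq_nonneg {d : ℕ} (x : Lat d) : 0 ≤ normSq x :=
  Finset.sum_nonneg fun _ _ => sq_nonneg _

lemma sq_le_normSq {d : ℕ} (x : Lat d) (i : Fin d) : (x i : ℝ) ^ 2 ≤ normSq x :=
  Finset.single_le_sum (f := fun i => (x i : ℝ) ^ 2) (fun _ _ => sq_nonneg _) (Finset.mem_univ i)

lemma normSq_add_single {d : ℕ} (x : Lat d) (i : Fin d) (e : ℤ) :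
    normSq (x + Pi.single i e) = normSq x + e ^ 2 + 2 * e * x i := by
  classical
  have h : ∀ j, (((x + Pi.single i e : Lat d) j : ℤ) : ℝ) ^ 2 =
      (x j : ℝ) ^ 2 + (if j = i then (e : ℝ) ^ 2 + 2 * e * x i else 0) := by
    intro j
    by_cases hj : j = i
    · subst hj; simp; ring
    · simp [hj]
  simp only [normSq, h, Finset.sum_add_distrib, Finset.sum_ite_eq', Finset.mem_univ, if_true]
  ring

/-- The function `(|x|² + a)^{-s}`. -/
def barrier {d : ℕ} (s a : ℝ) (x : Lat d) : ℝ := (normSq x + a) ^ (-s)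

lemma barrier_pos {d : ℕ} {s a : ℝ} (ha : 0 < a) (x : Lat d) : 0 < barrier s a x :=
  Real.rpow_pos_of_pos (add_pos_of_nonneg_of_pos (normSq_nonneg x) ha) _

/-- Adding the expansions in two opposite directions cancels the odd powers of `u`. As `u ^ 2 ≤ R`,
what the cubic and quartic terms leave is of order `R⁻²`, the order at which the shift `a` of the
barrier acts. -/
lemma pair_expansion_le {s C c R u : ℝ} (hC : 0 ≤ C) (hR : 1 ≤ R) (hu : u ^ 2 ≤ R) :
    (1 - s * ((1 + 2 * u) / R) + s * (s + 1) / 2 * ((1 + 2 * u) / R) ^ 2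
        + c * ((1 + 2 * u) / R) ^ 3 + C * ((1 + 2 * u) / R) ^ 4)
      + (1 - s * ((1 - 2 * u) / R) + s * (s + 1) / 2 * ((1 - 2 * u) / R) ^ 2
        + c * ((1 - 2 * u) / R) ^ 3 + C * ((1 - 2 * u) / R) ^ 4)
      ≤ 2 - 2 * s / R + s * (s + 1) * (1 + 4 * u ^ 2) / R ^ 2 + (26 * |c| + 82 * C) / R ^ 2 := by
  have hR0 : 0 < R := by linarith
  have e : (1 - s * ((1 + 2 * u) / R) + s * (s + 1) / 2 * ((1 + 2 * u) / R) ^ 2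
        + c * ((1 + 2 * u) / R) ^ 3 + C * ((1 + 2 * u) / R) ^ 4)
      + (1 - s * ((1 - 2 * u) / R) + s * (s + 1) / 2 * ((1 - 2 * u) / R) ^ 2
        + c * ((1 - 2 * u) / R) ^ 3 + C * ((1 - 2 * u) / R) ^ 4)
      = 2 - 2 * s / R + s * (s + 1) * (1 + 4 * u ^ 2) / R ^ 2
        + (c * (2 + 24 * u ^ 2) / R + C * (2 + 48 * u ^ 2 + 32 * u ^ 4) / R ^ 2) / R ^ 2 := by
    field_simp
    ring
  rw [e]
  gcongr
  · rw [div_le_iff₀ hR0]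
    have h1 : c * (2 + 24 * u ^ 2) ≤ |c| * (2 + 24 * u ^ 2) := by
      gcongr; exact le_abs_self c
    have h2 : |c| * (2 + 24 * u ^ 2) ≤ |c| * (26 * R) := by
      gcongr; linarith
    linarith
  · rw [div_le_iff₀ (by positivity)]
    have h4 : u ^ 4 ≤ R ^ 2 := by
      have : u ^ 4 = (u ^ 2) ^ 2 := by ring
      rw [this]; gcongr
    have hRR : R ≤ R ^ 2 := by nlinarith
    have : C * (2 + 48 * u ^ 2 + 32 * u ^ 4) ≤ C * (82 * R ^ 2) := by
      gcongr; nlinarith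
    linarith

/-- The lower bound on `a` keeps the relative increment `(1 + 2 * u) / R` within the range of the
Taylor bound for every `u`, through `2 * |u| ≤ δ * u ^ 2 + 1 / δ`. -/
lemma shift_rpow_le {s C c δ a R u : ℝ} (hδ : 0 < δ) (hδ1 : δ < 1)
    (H : ∀ t : ℝ, |t| ≤ δ →
      (1 + t) ^ (-s) ≤ 1 - s * t + s * (s + 1) / 2 * t ^ 2 + c * t ^ 3 + C * t ^ 4)
    (haδ : 1 / δ + 1 / δ ^ 2 ≤ a) (hR : u ^ 2 + a ≤ R) :
    (R + 1 + 2 * u) ^ (-s) ≤ R ^ (-s) * (1 - s * ((1 + 2 * u) / R)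
      + s * (s + 1) / 2 * ((1 + 2 * u) / R) ^ 2
      + c * ((1 + 2 * u) / R) ^ 3 + C * ((1 + 2 * u) / R) ^ 4) := by
  have ha : 0 < a := lt_of_lt_of_le (by positivity) haδ
  have hR0 : 0 < R := by nlinarith [sq_nonneg u]
  have ht : |(1 + 2 * u) / R| ≤ δ := by
    rw [abs_div, abs_of_pos hR0, div_le_iff₀ hR0]
    have h1 : |1 + 2 * u| ≤ 1 + 2 * |u| := by
      calc |1 + 2 * u| ≤ |1| + |2 * u| := abs_add_le _ _
        _ = _ := by rw [abs_mul]; norm_num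
    have h2 : 2 * |u| ≤ δ * u ^ 2 + 1 / δ := by
      have : 0 ≤ δ * (|u| - 1 / δ) ^ 2 := by positivity
      have e : δ * (|u| - 1 / δ) ^ 2 = δ * u ^ 2 - 2 * |u| + 1 / δ := by
        rw [sub_sq, sq_abs]; field_simp
      linarith
    have h3 : δ * (1 / δ + 1 / δ ^ 2) = 1 + 1 / δ := by field_simp
    have h4 : δ * (1 / δ + 1 / δ ^ 2) ≤ δ * a := by gcongr
    have h5 : δ * (u ^ 2 + a) ≤ δ * R := by gcongr
    linarith
  have h1t : 0 ≤ 1 + (1 + 2 * u) / R := by linarith [(abs_le.1 ht).1]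
  have : R + 1 + 2 * u = R * (1 + (1 + 2 * u) / R) := by field_simp; ring
  rw [this, Real.mul_rpow hR0.le h1t]
  gcongr
  exact H _ ht

/-- The exponent is that of the continuum Green function, so the terms of order `1 / R` cancel; a
large shift `a` makes the order `R⁻²` negative enough to beat the Taylor errors. -/
lemma exists_superharmonic_barrier (d : ℕ) (hd : 3 ≤ d) : ∃ a : ℝ, 0 < a ∧
    ∀ x : Lat d, stepAvg (barrier (((d : ℝ) - 2) / 2) a) x ≤
      barrier (((d : ℝ) - 2) / 2) a x * (1 - 1 / (2 * (normSq x + a) ^ 2)) := by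
  have hd' : (3 : ℝ) ≤ d := by exact_mod_cast hd
  set s : ℝ := ((d : ℝ) - 2) / 2 with hs
  have hs0 : 0 < s := by rw [hs]; linarith
  obtain ⟨C, c, δ, hC, hδ, hδ1, H⟩ := exists_rpow_neg_expansion s
  set K : ℝ := 26 * |c| + 82 * C with hK
  have hK0 : 0 ≤ K := by positivity
  -- The summands serve in turn `R ≥ 1`, the Taylor range, and `2 * s * a - s * (s + 1) - K ≥ 1`.
  refine ⟨1 + 1 / δ + 1 / δ ^ 2 + (s * (s + 1) + K + 1) / (2 * s), by positivity, fun x => ?_⟩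
  set a : ℝ := 1 + 1 / δ + 1 / δ ^ 2 + (s * (s + 1) + K + 1) / (2 * s) with ha
  have hp : 0 ≤ (s * (s + 1) + K + 1) / (2 * s) := by positivity
  have haδ : 1 / δ + 1 / δ ^ 2 ≤ a := by rw [ha]; linarith
  have ha1 : 1 ≤ a := by
    have : 0 ≤ 1 / δ + 1 / δ ^ 2 := by positivity
    rw [ha]; linarith
  have has : s * (s + 1) + K + 1 ≤ 2 * s * a := by
    have h1 : (s * (s + 1) + K + 1) / (2 * s) ≤ a := by
      have : 0 ≤ 1 / δ + 1 / δ ^ 2 := by positivity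
      rw [ha]; linarith
    rw [div_le_iff₀ (by positivity)] at h1
    linarith
  set R : ℝ := normSq x + a with hRdef
  have hR1 : 1 ≤ R := by have := normSq_nonneg x; linarith
  have hR0 : 0 < R := by linarith
  have hpair : ∀ i : Fin d, barrier s a (x + Pi.single i 1) + barrier s a (x - Pi.single i 1) ≤
      R ^ (-s) * (2 - 2 * s / R + s * (s + 1) * (1 + 4 * (x i : ℝ) ^ 2) / R ^ 2 + K / R ^ 2) := by
    intro i
    have hx := sq_le_normSq x i
    have e1 : barrier s a (x + Pi.single i 1) = (R + 1 + 2 * (x i : ℝ)) ^ (-s) := by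
      rw [barrier, normSq_add_single]; congr 1; push_cast; ring
    have e2 : barrier s a (x - Pi.single i 1) = (R + 1 + 2 * (-(x i : ℝ))) ^ (-s) := by
      rw [sub_eq_add_neg, ← Pi.single_neg, barrier, normSq_add_single]; congr 1; push_cast; ring
    have b1 := shift_rpow_le (u := (x i : ℝ)) (R := R) hδ hδ1 H haδ (by linarith)
    have b2 := shift_rpow_le (u := -(x i : ℝ)) (R := R) hδ hδ1 H haδ (by rw [neg_sq]; linarith)
    have b3 := pair_expansion_le (c := c) (s := s) (u := (x i : ℝ)) hC hR1 (by linarith)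
    have hRs : 0 < R ^ (-s) := Real.rpow_pos_of_pos hR0 _
    have b4 := mul_le_mul_of_nonneg_left b3 hRs.le
    have e3 : 1 + 2 * (-(x i : ℝ)) = 1 - 2 * (x i : ℝ) := by ring
    rw [e3] at b2
    rw [e1, e2]
    refine (add_le_add b1 b2).trans (le_trans (le_of_eq ?_) b4)
    ring
  have hsum : ∑ i : Fin d, (barrier s a (x + Pi.single i 1) + barrier s a (x - Pi.single i 1)) ≤
      R ^ (-s) * (2 * d - 2 * s * d / R + s * (s + 1) * (d + 4 * normSq x) / R ^ 2
        + d * K / R ^ 2) := by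
    refine (Finset.sum_le_sum fun i _ => hpair i).trans (le_of_eq ?_)
    rw [← Finset.mul_sum]
    congr 1
    simp only [Finset.sum_add_distrib, Finset.sum_sub_distrib, Finset.sum_const, Finset.card_univ,
      Fintype.card_fin, nsmul_eq_mul, ← Finset.sum_div, ← Finset.mul_sum, normSq]
    ring
  have hRs : 0 < R ^ (-s) := Real.rpow_pos_of_pos hR0 _
  have hb : barrier s a x = R ^ (-s) := rfl
  rw [stepAvg, hb]
  have hfin : 2 * d - 2 * s * d / R + s * (s + 1) * (d + 4 * normSq x) / R ^ 2 + d * K / R ^ 2 ≤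
      2 * d * (1 - 1 / (2 * R ^ 2)) := by
    have e4 : 4 * (s + 1) = 2 * (d : ℝ) := by rw [hs]; ring
    have hn : normSq x = R - a := by rw [hRdef]; ring
    have e5 : 2 * d - 2 * s * d / R + s * (s + 1) * (d + 4 * normSq x) / R ^ 2 + d * K / R ^ 2
        = 2 * d - d * (2 * s * a - s * (s + 1) - K) / R ^ 2 := by
      have : s * (s + 1) * (d + 4 * normSq x) = s * (s + 1) * d + s * (2 * d) * (R - a) := by
        rw [hn, ← e4]; ring
      rw [this]
      field_simp
      ring
    have e6 : 2 * d * (1 - 1 / (2 * R ^ 2)) = 2 * d - (d : ℝ) * 1 / R ^ 2 := by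
      field_simp
    rw [e5, e6]
    gcongr
    linarith
  calc 1 / (2 * (d : ℝ)) *
        ∑ i : Fin d, (barrier s a (x + Pi.single i 1) + barrier s a (x - Pi.single i 1))
      ≤ 1 / (2 * (d : ℝ)) * (R ^ (-s) * (2 * d * (1 - 1 / (2 * R ^ 2)))) := by
        gcongr
        exact hsum.trans (by gcongr)
    _ = R ^ (-s) * (1 - 1 / (2 * R ^ 2)) := by field_simp

/-- The barrier loses at least `k > 0` at the origin under one step and never gains elsewhere.
Decomposing at the first step, `k⁻¹ * f (x - y)` therefore dominates all partial sums of the Green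
series, which gives summability and the bound together. -/
lemma exists_green_bound_barrier (d : ℕ) (hd : 3 ≤ d) : ∃ a C : ℝ, 0 < a ∧ 0 < C ∧
    ∀ x y : Lat d, Summable (fun n => srwProb d n x y) ∧
      green d x y ≤ C * barrier (((d : ℝ) - 2) / 2) a (x - y) := by
  obtain ⟨a, ha, H⟩ := exists_superharmonic_barrier d hd
  set s : ℝ := ((d : ℝ) - 2) / 2 with hs
  set f : Lat d → ℝ := barrier s a with hf
  have hfpos : ∀ x, 0 < f x := fun x => barrier_pos ha x
  have hn0 : normSq (0 : Lat d) = 0 := by simp [normSq]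
  set k : ℝ := f 0 * (1 / (2 * a ^ 2)) with hk
  have hk0 : 0 < k := mul_pos (hfpos 0) (by positivity)
  have hsuper : ∀ x : Lat d, (if x = 0 then k else 0) + stepAvg f x ≤ f x := by
    intro x
    have h1 := H x
    split_ifs with hx
    · subst hx
      rw [hn0, zero_add] at h1
      rw [hk]; linarith
    · have hR : 0 < normSq x + a := add_pos_of_nonneg_of_pos (normSq_nonneg x) ha
      have : 0 ≤ f x * (1 / (2 * (normSq x + a) ^ 2)) := mul_nonneg (hfpos x).le (by positivity)
      linarith
  have hpartial : ∀ (n : ℕ) (x y : Lat d),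
      ∑ j ∈ Finset.range n, srwProb d j x y ≤ k⁻¹ * f (x - y) := by
    intro n
    induction n with
    | zero => intro x y; simpa using mul_nonneg (inv_pos.2 hk0).le (hfpos _).le
    | succ n ih =>
      intro x y
      rw [Finset.sum_range_succ']
      simp only [srwProb_succ, ← stepAvg_sum]
      have h1 := stepAvg_mono (fun z => ih z y) x
      rw [stepAvg_const_mul] at h1
      have h2 : stepAvg (fun z => f (z - y)) x = stepAvg f (x - y) := by
        simp only [stepAvg]
        congr 1
        exact Finset.sum_congr rfl fun i _ => by
          rw [add_sub_right_comm, sub_right_comm]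
      rw [h2] at h1
      have h3 := hsuper (x - y)
      have h4 : srwProb d 0 x y = k⁻¹ * (if x - y = 0 then k else 0) := by
        simp only [srwProb, sub_eq_zero]
        split_ifs
        · rw [inv_mul_cancel₀ hk0.ne']
        · simp
      rw [h4]
      have h5 := mul_le_mul_of_nonneg_left h3 (inv_pos.2 hk0).le
      linarith
  refine ⟨a, k⁻¹, ha, inv_pos.2 hk0, fun x y => ?_⟩
  have hsum := summable_of_sum_range_le (fun n => srwProb_nonneg d n x y) (fun n => hpartial n x y)
  exact ⟨hsum, hsum.tsum_le_of_sum_range_le fun n => hpartial n x y⟩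

lemma green_nonneg (d : ℕ) (x y : Lat d) : 0 ≤ green d x y :=
  tsum_nonneg fun n => srwProb_nonneg d n x y

lemma summable_srwProb {d : ℕ} (hd : 3 ≤ d) (x y : Lat d) : Summable fun n => srwProb d n x y := by
  obtain ⟨_, _, _, _, H⟩ := exists_green_bound_barrier d hd
  exact (H x y).1

/-- Off-diagonal decay of the Green function. -/
lemma exists_green_le (d : ℕ) (hd : 3 ≤ d) : ∃ C : ℝ, 0 < C ∧
    ∀ (x y : Lat d) (r : ℝ), 0 < r → r ≤ dist x y → green d x y ≤ C * (r ^ (d - 2))⁻¹ := by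
  obtain ⟨a, C, ha, hC, H⟩ := exists_green_bound_barrier d hd
  refine ⟨C, hC, fun x y r hr hxy => (H x y).2.trans ?_⟩
  gcongr
  have hd' : (3 : ℝ) ≤ d := by exact_mod_cast hd
  obtain ⟨i, hi⟩ : ∃ i, r ≤ dist (x i) (y i) := by
    by_contra! hcon
    exact absurd hxy (not_le.2 ((dist_pi_lt_iff hr).2 hcon))
  have h1 : r ^ 2 ≤ normSq (x - y) + a := by
    have := sq_le_normSq (x - y) i
    have h2 : dist (x i) (y i) ^ 2 = (((x - y) i : ℤ) : ℝ) ^ 2 := by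
      rw [Int.dist_eq, sq_abs]; simp
    have h3 : r ^ 2 ≤ dist (x i) (y i) ^ 2 := by gcongr
    linarith
  calc barrier (((d : ℝ) - 2) / 2) a (x - y)
      ≤ (r ^ 2) ^ (-(((d : ℝ) - 2) / 2)) :=
        Real.rpow_le_rpow_of_nonpos (by positivity) h1 (by linarith)
    _ = (r ^ (d - 2))⁻¹ := by
        rw [Real.rpow_neg (by positivity), ← Real.rpow_natCast r 2, ← Real.rpow_mul hr.le,
          ← Real.rpow_natCast r (d - 2)]
        congr 2
        push_cast [Nat.cast_sub (show 2 ≤ d by omega)]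
        ring

/-- The Green function inverts the discrete Laplacian. -/
lemma green_eq_add_stepAvg {d : ℕ} (hd : 3 ≤ d) (x y : Lat d) :
    green d x y = (if x = y then 1 else 0) + stepAvg (fun z => green d z y) x := by
  have hs := summable_srwProb hd
  rw [green, (hs x y).tsum_eq_zero_add]
  congr 1
  simp only [stepAvg, green]
  exact ((hasSum_sum fun i _ =>
    ((hs (x + Pi.single i 1) y).hasSum.add (hs (x - Pi.single i 1) y).hasSum)).mul_left
      (1 / (2 * (d : ℝ)))).tsum_eq

/-! ### The Green form and linear prediction -/

/-- The bilinear form `(c, c') ↦ ∑ c_x c'_y g(x,y)` on finitely supported functions. -/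
def greenForm (d : ℕ) : (Lat d →₀ ℝ) →ₗ[ℝ] (Lat d →₀ ℝ) →ₗ[ℝ] ℝ :=
  Finsupp.linearCombination ℝ fun x => Finsupp.linearCombination ℝ fun y => green d x y

lemma greenForm_single (d : ℕ) (x y : Lat d) (a b : ℝ) :
    greenForm d (Finsupp.single x a) (Finsupp.single y b) = a * (b * green d x y) := by
  simp [greenForm]

lemma greenForm_eq_sum (d : ℕ) (c c' : Lat d →₀ ℝ) :
    greenForm d c c' = ∑ z ∈ c'.support, c' z * greenForm d c (Finsupp.single z 1) := by
  conv_lhs => rw [← Finsupp.sum_single c']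
  rw [Finsupp.sum, map_sum]
  refine Finset.sum_congr rfl fun z _ => ?_
  rw [← smul_eq_mul, ← map_smul, Finsupp.smul_single_one]

/-- The linear functional of the field with coefficients `c`. -/
def fieldComb {d : ℕ} (c : Lat d →₀ ℝ) (φ : Lat d → ℝ) : ℝ := ∑ x ∈ c.support, c x * φ x

lemma fieldComb_eq_linearCombination {d : ℕ} (c : Lat d →₀ ℝ) (φ : Lat d → ℝ) :
    fieldComb c φ = Finsupp.linearCombination ℝ φ c := rfl

lemma measurable_fieldComb {d : ℕ} (c : Lat d →₀ ℝ) : Measurable (fieldComb c) := by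
  unfold fieldComb
  fun_prop

lemma IsGFF.memLp {d : ℕ} {P : Measure (Lat d → ℝ)} (hP : IsGFF d P) (x : Lat d) :
    MemLp (fun φ : Lat d → ℝ => φ x) 2 P :=
  (hP.isGaussianProcess.hasGaussianLaw_eval x).memLp_two

lemma IsGFF.integral_fieldComb_mul {d : ℕ} {P : Measure (Lat d → ℝ)} (hP : IsGFF d P)
    (c c' : Lat d →₀ ℝ) : ∫ φ, fieldComb c φ * fieldComb c' φ ∂P = greenForm d c c' := by
  simp only [fieldComb, Finset.sum_mul_sum]
  have hint : ∀ x y, Integrable (fun φ : Lat d → ℝ => c x * φ x * (c' y * φ y)) P := by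
    intro x y
    have := ((hP.memLp x).integrable_mul (hP.memLp y)).const_mul (c x * c' y)
    refine this.congr (Filter.Eventually.of_forall fun φ => ?_)
    simp only [Pi.mul_apply]; ring
  rw [integral_finsetSum _ fun x _ => integrable_finsetSum _ fun y _ => hint x y]
  simp only [greenForm, Finsupp.linearCombination_apply, Finsupp.sum, LinearMap.sum_apply,
    LinearMap.smul_apply, smul_eq_mul]
  refine Finset.sum_congr rfl fun x _ => ?_
  rw [integral_finsetSum _ fun y _ => hint x y, Finset.mul_sum]
  refine Finset.sum_congr rfl fun y _ => ?_
  rw [← hP.covariance x y, ← integral_const_mul, ← integral_const_mul]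
  congr 1
  ext φ
  ring

lemma IsGFF.greenForm_self_nonneg {d : ℕ} {P : Measure (Lat d → ℝ)} (hP : IsGFF d P)
    (c : Lat d →₀ ℝ) : 0 ≤ greenForm d c c := by
  rw [← hP.integral_fieldComb_mul]
  exact integral_nonneg fun φ => mul_self_nonneg _

lemma IsGFF.greenForm_comm {d : ℕ} {P : Measure (Lat d → ℝ)} (hP : IsGFF d P)
    (c c' : Lat d →₀ ℝ) : greenForm d c c' = greenForm d c' c := by
  rw [← hP.integral_fieldComb_mul, ← hP.integral_fieldComb_mul]
  simp only [mul_comm]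

/-- The point mass at `x` minus its one-step average. -/
def laplaceMass {d : ℕ} (x : Lat d) : Lat d →₀ ℝ :=
  Finsupp.single x 1 - (1 / (2 * (d : ℝ))) •
    ∑ i : Fin d, (Finsupp.single (x + Pi.single i 1) 1 + Finsupp.single (x - Pi.single i 1) 1)

/-- Pairing with `laplaceMass x` reads off the coefficient at `x`, because the Green form inverts
the Laplacian. -/
lemma greenForm_laplaceMass {d : ℕ} (hd : 3 ≤ d) (x : Lat d) (c : Lat d →₀ ℝ) :
    greenForm d (laplaceMass x) c = c x := by
  induction c using Finsupp.induction_linear with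
  | zero => simp
  | add f g hf hg => rw [map_add, hf, hg, Finsupp.add_apply]
  | single y b =>
    have := green_eq_add_stepAvg hd x y
    have h2 : greenForm d (laplaceMass x) (Finsupp.single y b) =
        b * (green d x y - stepAvg (fun z => green d z y) x) := by
      simp only [laplaceMass, map_sub, map_smul, map_sum, map_add, LinearMap.sub_apply,
        LinearMap.smul_apply, LinearMap.sum_apply, LinearMap.add_apply, greenForm_single, one_mul,
        smul_eq_mul, stepAvg, ← mul_add, ← Finset.mul_sum]
      ring
    rw [h2, this, Finsupp.single_apply]
    simp only [eq_comm (a := x), add_sub_cancel_right, mul_ite, mul_one, mul_zero]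

/-- Multiplication by the discrete Laplacian. -/
def laplace (d : ℕ) : (Lat d →₀ ℝ) →ₗ[ℝ] (Lat d →₀ ℝ) :=
  Finsupp.linearCombination ℝ laplaceMass

lemma greenForm_laplace {d : ℕ} (hd : 3 ≤ d) (c c' : Lat d →₀ ℝ) :
    greenForm d (laplace d c) c' = ∑ x ∈ c.support, c x * c' x := by
  rw [laplace, Finsupp.linearCombination_apply, Finsupp.sum, map_sum, LinearMap.sum_apply]
  refine Finset.sum_congr rfl fun x _ => ?_
  rw [map_smul, LinearMap.smul_apply, greenForm_laplaceMass hd, smul_eq_mul]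

lemma laplace_apply {d : ℕ} (c : Lat d →₀ ℝ) (x : Lat d) :
    laplace d c x = c x - stepAvg c x := by
  induction c using Finsupp.induction_linear with
  | zero => simp [stepAvg]
  | add f g hf hg =>
    rw [map_add, Finsupp.add_apply, hf, hg, Finsupp.add_apply]
    have := stepAvg_add f g x
    simp only [Finsupp.coe_add] at *
    rw [show (⇑f + ⇑g) = fun z => f z + g z from rfl, this]
    ring
  | single y b =>
    simp only [laplace, Finsupp.linearCombination_single, laplaceMass, stepAvg, Finsupp.smul_apply,
      Finsupp.sub_apply, Finsupp.finsetSum_apply, Finsupp.add_apply, smul_eq_mul]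
    rw [mul_sub, mul_left_comm, Finset.mul_sum]
    have e : ∀ z : Lat d, b * (Finsupp.single z (1 : ℝ) x) = Finsupp.single z b x := by
      intro z; simp [Finsupp.single_apply]
    simp only [mul_add, e]
    congr 2
    refine Finset.sum_congr rfl fun i _ => ?_
    rw [add_comm]
    simp only [Finsupp.single_apply, sub_eq_iff_eq_add, eq_sub_iff_add_eq]

/-- A shift does not increase the sum of squares over the support; combine with `-(a * b) ≤ (a ^ 2 +
b ^ 2) / 2`. -/
lemma neg_sum_mul_shift_le {d : ℕ} (c : Lat d →₀ ℝ) (e : Lat d) :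
    -∑ x ∈ c.support, c x * c (x + e) ≤ ∑ x ∈ c.support, c x ^ 2 := by
  have h1 : ∑ x ∈ c.support, c (x + e) ^ 2 ≤ ∑ x ∈ c.support, c x ^ 2 := by
    classical
    rw [← Finset.sum_image (s := c.support) (g := fun x => x + e) (f := fun x => c x ^ 2)
      (fun x _ y _ h => add_right_cancel h)]
    have : ∑ x ∈ (c.support.image fun x => x + e) ∩ c.support, c x ^ 2 =
        ∑ x ∈ c.support.image fun x => x + e, c x ^ 2 := by
      refine Finset.sum_subset Finset.inter_subset_left fun x hx hx' => ?_
      have : x ∉ c.support := fun h => hx' (Finset.mem_inter.2 ⟨hx, h⟩)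
      rw [Finsupp.notMem_support_iff.1 this]; norm_num
    rw [← this]
    exact Finset.sum_le_sum_of_subset_of_nonneg Finset.inter_subset_right
      fun _ _ _ => sq_nonneg _
  have h2 : ∀ x ∈ c.support, -(c x * c (x + e)) ≤ (c x ^ 2 + c (x + e) ^ 2) / 2 :=
    fun x _ => by nlinarith [sq_nonneg (c x + c (x + e))]
  have h3 := Finset.sum_le_sum h2
  rw [Finset.sum_neg_distrib, ← Finset.sum_div, Finset.sum_add_distrib] at h3
  linarith

/-- The left side is `⟨c, (I - P) c⟩`, and the walk operator `P` is at least `-1`. -/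
lemma greenForm_laplace_self_le {d : ℕ} (hd : 3 ≤ d) (c : Lat d →₀ ℝ) :
    greenForm d (laplace d c) (laplace d c) ≤ 2 * ∑ x ∈ c.support, c x ^ 2 := by
  have hd0 : (0 : ℝ) < d := by exact_mod_cast (by omega : 0 < d)
  rw [greenForm_laplace hd]
  have e : ∑ x ∈ c.support, c x * laplace d c x = ∑ x ∈ c.support, c x ^ 2 +
      (1 / (2 * (d : ℝ))) * ∑ i : Fin d, ((-∑ x ∈ c.support, c x * c (x + Pi.single i 1)) +
        (-∑ x ∈ c.support, c x * c (x + (-Pi.single i 1)))) := by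
    simp only [laplace_apply, stepAvg, ← Finset.sum_neg_distrib, ← Finset.sum_add_distrib]
    rw [Finset.sum_comm, Finset.mul_sum, ← Finset.sum_add_distrib]
    refine Finset.sum_congr rfl fun x _ => ?_
    have : ∑ i : Fin d, (-(c x * c (x + Pi.single i 1)) + -(c x * c (x + -Pi.single i 1))) =
        - c x * ∑ i : Fin d, (c (x + Pi.single i 1) + c (x - Pi.single i 1)) := by
      rw [Finset.mul_sum]
      exact Finset.sum_congr rfl fun i _ => by rw [sub_eq_add_neg]; ring
    rw [this]; ring
  rw [e]
  have h : ∑ i : Fin d, ((-∑ x ∈ c.support, c x * c (x + Pi.single i 1)) +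
        (-∑ x ∈ c.support, c x * c (x + (-Pi.single i 1)))) ≤
      ∑ _i : Fin d, 2 * ∑ x ∈ c.support, c x ^ 2 :=
    Finset.sum_le_sum fun i _ => by
      have h1 := neg_sum_mul_shift_le c (Pi.single i 1)
      have h2 := neg_sum_mul_shift_le c (-Pi.single i 1)
      linarith
  have h' := mul_le_mul_of_nonneg_left h (by positivity : 0 ≤ 1 / (2 * (d : ℝ)))
  have e2 : (1 / (2 * (d : ℝ))) * ∑ _i : Fin d, 2 * ∑ x ∈ c.support, c x ^ 2 =
      ∑ x ∈ c.support, c x ^ 2 := by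
    simp only [Finset.sum_const, Finset.card_univ, Fintype.card_fin, nsmul_eq_mul]
    field_simp
  linarith

/-- The Green form is bounded below by half the Euclidean norm. -/
lemma IsGFF.sum_sq_le {d : ℕ} (hd : 3 ≤ d) {P : Measure (Lat d → ℝ)} (hP : IsGFF d P)
    (c : Lat d →₀ ℝ) : ∑ x ∈ c.support, c x ^ 2 ≤ 2 * greenForm d c c := by
  -- Writing `G` for the Green form, expanding at this vector gives `0 ≤ G(c,c) - |c|² + G(Lc,Lc)/4`
  -- with `L = I - P`, and the last term is at most `|c|² / 2`.
  have h := hP.greenForm_self_nonneg (c - (1 / 2 : ℝ) • laplace d c)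
  have h2 := greenForm_laplace_self_le hd c
  have h3 := greenForm_laplace hd c c
  have h4 := hP.greenForm_comm c (laplace d c)
  simp only [map_sub, map_smul, LinearMap.sub_apply, LinearMap.smul_apply, smul_eq_mul] at h
  rw [h4, h3] at h
  simp only [← sq] at h
  linarith

/-- Existence of the best linear predictor of `φ_x` from the values on a finite set. -/
lemma IsGFF.exists_predictor {d : ℕ} (hd : 3 ≤ d) {P : Measure (Lat d → ℝ)} (hP : IsGFF d P)
    (S : Finset (Lat d)) (x : Lat d) : ∃ w : Lat d →₀ ℝ, w.support ⊆ S ∧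
      ∀ z ∈ S, greenForm d w (Finsupp.single z 1) = green d x z := by
  classical
  let emb : (S → ℝ) →ₗ[ℝ] (Lat d →₀ ℝ) :=
    (Finsupp.lmapDomain ℝ ℝ (Subtype.val : S → Lat d)) ∘ₗ
      (Finsupp.linearEquivFunOnFinite ℝ ℝ S).symm.toLinearMap
  have hsupp : ∀ v, (emb v).support ⊆ S := by
    intro v y hy
    have := Finsupp.mapDomain_support hy
    obtain ⟨z, _, rfl⟩ := Finset.mem_image.1 this
    exact z.2
  have hinj : Function.Injective emb :=
    (Finsupp.mapDomain_injective Subtype.val_injective).comp (LinearEquiv.injective _)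
  let F : (S → ℝ) →ₗ[ℝ] (S → ℝ) :=
    LinearMap.pi fun z => ((greenForm d).flip (Finsupp.single z.1 1)) ∘ₗ emb
  -- The Gram matrix on `S` is definite by `sum_sq_le`; in finite dimension its injectivity yields
  -- the predictor.
  have hF : Function.Injective F := by
    rw [← LinearMap.ker_eq_bot, LinearMap.ker_eq_bot']
    intro v hv
    have h0 : ∀ z ∈ S, greenForm d (emb v) (Finsupp.single z 1) = 0 := fun z hz =>
      congrFun hv ⟨z, hz⟩
    have h1 : greenForm d (emb v) (emb v) = 0 := by
      rw [greenForm_eq_sum]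
      exact Finset.sum_eq_zero fun z hz => by rw [h0 z (hsupp v hz), mul_zero]
    have h2 := hP.sum_sq_le hd (emb v)
    rw [h1, mul_zero] at h2
    have h3 : emb v = 0 := by
      ext y
      by_contra hy
      have hy' : y ∈ (emb v).support := Finsupp.mem_support_iff.2 hy
      have := Finset.single_le_sum (f := fun x => emb v x ^ 2) (fun _ _ => sq_nonneg _) hy'
      have hp : 0 < emb v y ^ 2 := sq_pos_of_ne_zero hy
      linarith
    exact hinj (h3.trans (map_zero emb).symm)
  obtain ⟨v, hv⟩ := (LinearMap.injective_iff_surjective.1 hF) fun z => green d x z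
  exact ⟨emb v, hsupp v, fun z hz => congrFun hv ⟨z, hz⟩⟩

/-- The variance of the best linear predictor. -/
lemma IsGFF.predictor_variance_le {d : ℕ} (hd : 3 ≤ d) {P : Measure (Lat d → ℝ)}
    (hP : IsGFF d P) {S : Finset (Lat d)} {x : Lat d} {w : Lat d →₀ ℝ} (hw : w.support ⊆ S)
    (h : ∀ z ∈ S, greenForm d w (Finsupp.single z 1) = green d x z) {D : ℝ}
    (hD : ∀ z ∈ S, green d x z ≤ D) : greenForm d w w ≤ 2 * (S.card * D ^ 2) := by
  set B := greenForm d w w with hB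
  have hB0 : 0 ≤ B := hP.greenForm_self_nonneg w
  have e : B = ∑ z ∈ w.support, w z * green d x z := by
    rw [hB, greenForm_eq_sum]
    exact Finset.sum_congr rfl fun z hz => by rw [h z (hw hz)]
  -- Cauchy-Schwarz together with `sum_sq_le` gives `B ^ 2 ≤ 2 * B * (S.card * D ^ 2)`; one factor
  -- `B` is then cancelled.
  have h1 : B ^ 2 ≤ (∑ z ∈ w.support, w z ^ 2) * ∑ z ∈ w.support, green d x z ^ 2 := by
    rw [e]; exact Finset.sum_mul_sq_le_sq_mul_sq _ _ _
  have h2 : ∑ z ∈ w.support, green d x z ^ 2 ≤ S.card * D ^ 2 := by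
    calc ∑ z ∈ w.support, green d x z ^ 2 ≤ ∑ z ∈ S, green d x z ^ 2 :=
          Finset.sum_le_sum_of_subset_of_nonneg hw fun _ _ _ => sq_nonneg _
      _ ≤ ∑ z ∈ S, D ^ 2 := Finset.sum_le_sum fun z hz => by
          have := green_nonneg d x z
          have := hD z hz
          gcongr
      _ = S.card * D ^ 2 := by simp
  have h3 := hP.sum_sq_le hd w
  have hQ : 0 ≤ (S.card : ℝ) * D ^ 2 := by positivity
  have h4 : B ^ 2 ≤ 2 * B * (S.card * D ^ 2) := h1.trans (by gcongr)
  by_contra! hcon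
  nlinarith

/-- Maximum principle on a finite set `K` with boundary `S`. -/
lemma nonpos_of_harmonic {d : ℕ} (hd : 0 < d) {K S : Finset (Lat d)} {u : Lat d → ℝ}
    (hint : ∀ y ∈ K, y ∉ S → ∀ i, y + Pi.single i 1 ∈ K ∧ y - Pi.single i 1 ∈ K)
    (hharm : ∀ y ∈ K, y ∉ S → u y = stepAvg u y) (hS : ∀ y ∈ S, u y = 0) :
    ∀ y ∈ K, u y ≤ 0 := by
  intro y₀ hy₀
  obtain ⟨m, hm, hmax⟩ := K.exists_max_image u ⟨y₀, hy₀⟩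
  refine (hmax y₀ hy₀).trans ?_
  classical
  let j : Fin d := ⟨0, hd⟩
  -- Among the maximizers, one with largest coordinate `j` has a strictly smaller neighbor in
  -- direction `j`, so off `S` it would exceed the average over its neighbors.
  obtain ⟨y, hy, hymax⟩ := (K.filter fun z => u z = u m).exists_max_image (fun z => z j)
    ⟨m, by simp [hm]⟩
  rw [Finset.mem_filter] at hy
  by_cases hyS : y ∈ S
  · rw [← hy.2, hS y hyS]
  exfalso
  have hnb := hint y hy.1 hyS
  have hle : ∀ i, u (y + Pi.single i 1) + u (y - Pi.single i 1) ≤ 2 * u m := fun i => by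
    have := hmax _ (hnb i).1
    have := hmax _ (hnb i).2
    linarith
  have hlt : u (y + Pi.single j 1) < u m := by
    refine lt_of_le_of_ne (hmax _ (hnb j).1) fun heq => ?_
    have := hymax _ (Finset.mem_filter.2 ⟨(hnb j).1, heq⟩)
    simp at this
  have hsum : ∑ i : Fin d, (u (y + Pi.single i 1) + u (y - Pi.single i 1)) <
      ∑ _i : Fin d, 2 * u m :=
    Finset.sum_lt_sum (fun i _ => hle i) ⟨j, Finset.mem_univ _, by
      have := hmax _ (hnb j).2
      linarith⟩
  have hd0 : (0 : ℝ) < d := by exact_mod_cast hd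
  have h1 := hharm y hy.1 hyS
  rw [hy.2, stepAvg] at h1
  have h2 := mul_lt_mul_of_pos_left hsum (by positivity : 0 < 1 / (2 * (d : ℝ)))
  rw [← h1] at h2
  have e2 : (1 / (2 * (d : ℝ))) * ∑ _i : Fin d, 2 * u m = u m := by
    simp only [Finset.sum_const, Finset.card_univ, Fintype.card_fin, nsmul_eq_mul]
    field_simp
  linarith

lemma eq_zero_of_harmonic {d : ℕ} (hd : 0 < d) {K S : Finset (Lat d)} {u : Lat d → ℝ}
    (hint : ∀ y ∈ K, y ∉ S → ∀ i, y + Pi.single i 1 ∈ K ∧ y - Pi.single i 1 ∈ K)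
    (hharm : ∀ y ∈ K, y ∉ S → u y = stepAvg u y) (hS : ∀ y ∈ S, u y = 0) :
    ∀ y ∈ K, u y = 0 := by
  intro y hy
  refine le_antisymm (nonpos_of_harmonic hd hint hharm hS y hy) ?_
  have h := nonpos_of_harmonic hd (u := fun z => (-1) * u z) hint
    (fun z hz hzS => by rw [stepAvg_const_mul, ← hharm z hz hzS])
    (fun z hz => by rw [hS z hz, mul_zero]) y hy
  linarith

/-- The spatial Markov property, in covariance form: the residual of the prediction from the
boundary `S` is uncorrelated with the whole field on `K`. -/
lemma IsGFF.residual_orthogonal {d : ℕ} (hd : 3 ≤ d) {P : Measure (Lat d → ℝ)} (hP : IsGFF d P)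
    {K S : Finset (Lat d)} {x : Lat d} (hx : x ∉ K)
    (hint : ∀ y ∈ K, y ∉ S → ∀ i, y + Pi.single i 1 ∈ K ∧ y - Pi.single i 1 ∈ K)
    {w : Lat d →₀ ℝ} (hw : w.support ⊆ S)
    (h : ∀ z ∈ S, greenForm d w (Finsupp.single z 1) = green d x z) :
    ∀ y ∈ K, greenForm d (Finsupp.single x 1 - w) (Finsupp.single y 1) = 0 := by
  -- As a function of `y` the covariance vanishes on `S` by the choice of `w`. It is harmonic on the
  -- rest of `K`, where the coefficients of the residual vanish since `x ∉ K`.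
  refine eq_zero_of_harmonic (S := S) (by omega) hint (fun y hy hyS => ?_) fun z hz => ?_
  · have h1 := greenForm_laplaceMass hd y (Finsupp.single x 1 - w)
    have h2 : (Finsupp.single x 1 - w : Lat d →₀ ℝ) y = 0 := by
      have hne : x ≠ y := fun e => hx (e ▸ hy)
      have hwy : w y = 0 := Finsupp.notMem_support_iff.1 fun h' => hyS (hw h')
      simp [hne, hwy]
    rw [h2, hP.greenForm_comm] at h1
    rw [← sub_eq_zero, ← h1]
    simp only [laplaceMass, map_sub, map_smul, map_sum, map_add, smul_eq_mul, stepAvg]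
  · rw [map_sub, LinearMap.sub_apply, h z hz, greenForm_single]
    ring

/-! ### Gaussian tails and decoupling -/

lemma IsGFF.isGaussianProcess_fieldComb {d : ℕ} {P : Measure (Lat d → ℝ)} (hP : IsGFF d P)
    {T : Type*} (c : T → Lat d →₀ ℝ) : IsGaussianProcess (fun t => fieldComb (c t)) P := by
  refine hP.isGaussianProcess.of_isGaussianProcess fun t => ⟨(c t).support,
    ∑ i : (c t).support, (c t i) • ContinuousLinearMap.proj (R := ℝ) i, fun φ => ?_⟩
  rw [fieldComb, ← Finset.sum_coe_sort]
  simp [Finset.restrict]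

lemma IsGFF.integral_fieldComb {d : ℕ} {P : Measure (Lat d → ℝ)} (hP : IsGFF d P)
    (c : Lat d →₀ ℝ) : ∫ φ, fieldComb c φ ∂P = 0 := by
  have := hP.isProbabilityMeasure
  simp only [fieldComb]
  rw [integral_finsetSum _ fun x _ => ((hP.memLp x).integrable one_le_two).const_mul _]
  exact Finset.sum_eq_zero fun x _ => by rw [integral_const_mul, hP.mean, mul_zero]

lemma IsGFF.memLp_fieldComb {d : ℕ} {P : Measure (Lat d → ℝ)} (hP : IsGFF d P)
    (c : Lat d →₀ ℝ) : MemLp (fieldComb c) 2 P :=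
  ((hP.isGaussianProcess_fieldComb fun _ : Unit => c).hasGaussianLaw_eval ()).memLp_two

lemma IsGFF.covariance_fieldComb {d : ℕ} {P : Measure (Lat d → ℝ)} (hP : IsGFF d P)
    (c c' : Lat d →₀ ℝ) : cov[fieldComb c, fieldComb c'; P] = greenForm d c c' := by
  have := hP.isProbabilityMeasure
  rw [covariance_eq_sub (hP.memLp_fieldComb c) (hP.memLp_fieldComb c'), hP.integral_fieldComb,
    zero_mul, sub_zero, ← hP.integral_fieldComb_mul]
  rfl

lemma IsGFF.hasSubgaussianMGF_fieldComb {d : ℕ} {P : Measure (Lat d → ℝ)} (hP : IsGFF d P)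
    (c : Lat d →₀ ℝ) {V : ℝ} (hV : greenForm d c c ≤ V) :
    HasSubgaussianMGF (fieldComb c) V.toNNReal P := by
  have := hP.isProbabilityMeasure
  have hlaw :=
    ((hP.isGaussianProcess_fieldComb fun _ : Unit => c).hasGaussianLaw_eval ()).map_eq_gaussianReal
  have hvar : Var[fieldComb c; P] = greenForm d c c := by
    rw [← covariance_self (measurable_fieldComb c).aemeasurable, hP.covariance_fieldComb]
  simp only [hP.integral_fieldComb, hvar] at hlaw
  have hm : AEMeasurable (fieldComb c) P := (measurable_fieldComb c).aemeasurable
  rw [← HasSubgaussianMGF.id_map_iff hm, hlaw]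
  refine ⟨fun t => ?_, fun t => ?_⟩
  · exact integrable_exp_mul_gaussianReal t
  · rw [mgf_id_gaussianReal]
    apply Real.exp_le_exp.2
    have : ((greenForm d c c).toNNReal : ℝ) ≤ V.toNNReal := by
      exact_mod_cast Real.toNNReal_le_toNNReal hV
    have h2 := sq_nonneg t
    nlinarith

lemma IsGFF.measureReal_abs_fieldComb_ge_le {d : ℕ} {P : Measure (Lat d → ℝ)} (hP : IsGFF d P)
    (c : Lat d →₀ ℝ) {V γ : ℝ} (hV : greenForm d c c ≤ V) (hγ : 0 ≤ γ) :
    P.real {φ | γ ≤ |fieldComb c φ|} ≤ 2 * Real.exp (-γ ^ 2 / (2 * V)) := by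
  have := hP.isProbabilityMeasure
  have hV0 : 0 ≤ V := (hP.greenForm_self_nonneg c).trans hV
  have h := hP.hasSubgaussianMGF_fieldComb c hV
  have h1 := h.measure_ge_le hγ
  have h2 := h.neg.measure_ge_le hγ
  rw [Real.coe_toNNReal V hV0] at h1 h2
  have hsub : {φ | γ ≤ |fieldComb c φ|} ⊆ {φ | γ ≤ fieldComb c φ} ∪ {φ | γ ≤ (-fieldComb c) φ} :=
    fun φ (hφ : γ ≤ |fieldComb c φ|) => (le_abs.1 hφ).elim Or.inl Or.inr
  have h3 := (measureReal_mono (μ := P) hsub).trans (measureReal_union_le _ _)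
  linarith

/-- `A` only depends on the coordinates in `K`. -/
def LocalOn {d : ℕ} {β : Type*} (K : Set (Lat d)) (A : Set (Lat d → β)) : Prop :=
  ∀ φ φ' : Lat d → β, (∀ x ∈ K, φ x = φ' x) → φ ∈ A → φ' ∈ A

/-- Extension by zero outside a finite set. -/
def zeroExtend {d : ℕ} (K : Finset (Lat d)) (v : K → ℝ) (x : Lat d) : ℝ :=
  open Classical in if h : x ∈ K then v ⟨x, h⟩ else 0

lemma measurable_zeroExtend {d : ℕ} (K : Finset (Lat d)) : Measurable (zeroExtend K) := by
  classical
  refine measurable_pi_lambda _ fun x => ?_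
  unfold zeroExtend
  by_cases h : x ∈ K
  · simpa [h] using measurable_pi_apply _
  · simp [h]

lemma LocalOn.zeroExtend_mem_iff {d : ℕ} {K : Finset (Lat d)} {A : Set (Lat d → ℝ)}
    (hA : LocalOn K A) (φ : Lat d → ℝ) : zeroExtend K (fun x => φ x) ∈ A ↔ φ ∈ A := by
  have : ∀ x ∈ (K : Set (Lat d)), zeroExtend K (fun x => φ x) x = φ x := fun x hx => by
    have hx' : x ∈ K := hx
    simp [zeroExtend, hx']
  exact ⟨hA _ _ this, hA _ _ fun x hx => (this x hx).symm⟩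

/-- Events depending on the field in `K₁`, respectively on the residual field in `K₂`, are
independent if these fields are uncorrelated. -/
lemma IsGFF.measureReal_inter_residual {d : ℕ} {P : Measure (Lat d → ℝ)} (hP : IsGFF d P)
    {K₁ K₂ : Finset (Lat d)} {c : Lat d → Lat d →₀ ℝ}
    (horth : ∀ x ∈ K₂, ∀ y ∈ K₁, greenForm d (c x) (Finsupp.single y 1) = 0)
    {A₁ A₂ : Set (Lat d → ℝ)} (hA₁ : MeasurableSet A₁) (hA₂ : MeasurableSet A₂)
    (hl₁ : LocalOn K₁ A₁) (hl₂ : LocalOn K₂ A₂) :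
    P.real (A₁ ∩ {φ | (fun x => fieldComb (c x) φ) ∈ A₂}) =
      P.real A₁ * P.real {φ | (fun x => fieldComb (c x) φ) ∈ A₂} := by
  have := hP.isProbabilityMeasure
  have hsingle : ∀ (y : Lat d) (φ : Lat d → ℝ), fieldComb (Finsupp.single y 1) φ = φ y := by
    intro y φ
    rw [fieldComb_eq_linearCombination]; simp
  let X : K₁ → (Lat d → ℝ) → ℝ := fun y => fieldComb (Finsupp.single y.1 1)
  let Y : K₂ → (Lat d → ℝ) → ℝ := fun x => fieldComb (c x)
  -- Joint Gaussianity turns vanishing covariances into independence.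
  have hG : IsGaussianProcess (Sum.elim X Y) P := by
    convert! hP.isGaussianProcess_fieldComb
      (Sum.elim (fun y : K₁ => Finsupp.single y.1 1) (fun x : K₂ => c x)) using 1
    ext t φ
    cases t <;> rfl
  have hind := hG.indepFun_of_covariance_eq_zero
    (fun s => (measurable_fieldComb _).aemeasurable) (fun t => (measurable_fieldComb _).aemeasurable)
    (fun s t => by
      rw [hP.covariance_fieldComb, hP.greenForm_comm]
      exact horth _ t.2 _ s.2)
  have hmul := hind.measure_inter_preimage_eq_mul _ _
    (measurable_zeroExtend K₁ hA₁) (measurable_zeroExtend K₂ hA₂)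
  have e₁ : (fun φ s => X s φ) ⁻¹' (zeroExtend K₁ ⁻¹' A₁) = A₁ := by
    ext φ
    simp only [X, hsingle, mem_preimage]
    exact hl₁.zeroExtend_mem_iff φ
  have e₂ : (fun φ t => Y t φ) ⁻¹' (zeroExtend K₂ ⁻¹' A₂) =
      {φ | (fun x => fieldComb (c x) φ) ∈ A₂} := by
    ext φ
    exact hl₂.zeroExtend_mem_iff fun x => fieldComb (c x) φ
  rw [e₁, e₂] at hmul
  simp only [measureReal_def, hmul, ENNReal.toReal_mul]

/-- Decoupling of the field in two finite sets, at the price of a perturbation of size `2γ`. -/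
lemma IsGFF.decoupling {d : ℕ} (hd : 3 ≤ d) {P : Measure (Lat d → ℝ)} (hP : IsGFF d P)
    {K₁ S K₂ : Finset (Lat d)} (hdisj : ∀ x ∈ K₂, x ∉ K₁)
    (hint : ∀ y ∈ K₁, y ∉ S → ∀ i, y + Pi.single i 1 ∈ K₁ ∧ y - Pi.single i 1 ∈ K₁)
    {D V γ : ℝ} (hD : ∀ x ∈ K₂, ∀ z ∈ S, green d x z ≤ D) (hV : 2 * (S.card * D ^ 2) ≤ V)
    (hγ : 0 ≤ γ) {A₁ A₂ A₂' A₂'' : Set (Lat d → ℝ)}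
    (hA₁ : MeasurableSet A₁) (hA₂' : MeasurableSet A₂') (hl₁ : LocalOn K₁ A₁)
    (hl₂ : LocalOn K₂ A₂')
    (hstep : ∀ φ φ' : Lat d → ℝ, (∀ x, |φ x - φ' x| ≤ γ) → φ ∈ A₂ → φ' ∈ A₂')
    (hstep' : ∀ φ φ' : Lat d → ℝ, (∀ x, |φ x - φ' x| ≤ γ) → φ ∈ A₂' → φ' ∈ A₂'') :
    P.real (A₁ ∩ A₂) ≤ P.real A₁ * P.real A₂'' +
      2 * (K₂.card * (2 * Real.exp (-γ ^ 2 / (2 * V)))) := by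
  classical
  have := hP.isProbabilityMeasure
  choose w hwS hw using hP.exists_predictor hd S
  -- The residual replaces the field in `K₂` only, so that closeness off the bad event holds at
  -- every site, as `hstep` requires.
  let c : Lat d → Lat d →₀ ℝ := fun x => Finsupp.single x 1 - if x ∈ K₂ then w x else 0
  let ψ : (Lat d → ℝ) → Lat d → ℝ := fun φ x => fieldComb (c x) φ
  let bad : Set (Lat d → ℝ) := ⋃ x ∈ K₂, {φ | γ ≤ |fieldComb (w x) φ|}
  have hψ : ∀ φ x, φ x - ψ φ x = if x ∈ K₂ then fieldComb (w x) φ else 0 := by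
    intro φ x
    simp only [ψ, c, fieldComb_eq_linearCombination, map_sub]
    split_ifs <;> simp
  have hclose : ∀ φ, φ ∉ bad → ∀ x, |φ x - ψ φ x| ≤ γ := by
    intro φ hφ x
    rw [hψ]
    split_ifs with hx
    · simp only [bad, mem_iUnion, not_exists, mem_ofPred_eq, not_le] at hφ
      exact (hφ x hx).le
    · simpa using hγ
  have hbad : P.real bad ≤ K₂.card * (2 * Real.exp (-γ ^ 2 / (2 * V))) := by
    refine (measureReal_biUnion_finset_le _ _).trans ?_
    rw [← nsmul_eq_mul]
    refine Finset.sum_le_card_nsmul _ _ _ fun x hx => ?_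
    exact hP.measureReal_abs_fieldComb_ge_le (w x)
      ((hP.predictor_variance_le hd (hwS x) (hw x) (hD x hx)).trans hV) hγ
  have hprod : P.real (A₁ ∩ {φ | ψ φ ∈ A₂'}) = P.real A₁ * P.real {φ | ψ φ ∈ A₂'} := by
    refine hP.measureReal_inter_residual (fun x hx => ?_) hA₁ hA₂' hl₁ hl₂
    simp only [c, if_pos hx]
    exact hP.residual_orthogonal hd (hdisj x hx) hint (hwS x) (hw x)
  have h1 : P.real (A₁ ∩ A₂) ≤ P.real (A₁ ∩ {φ | ψ φ ∈ A₂'}) + P.real bad := by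
    refine (measureReal_mono (fun φ hφ => ?_)).trans (measureReal_union_le _ _)
    by_cases hb : φ ∈ bad
    · exact Or.inr hb
    · exact Or.inl ⟨hφ.1, hstep φ _ (hclose φ hb) hφ.2⟩
  -- The return from the residual to the field pays for the bad event a second time.
  have h2 : P.real {φ | ψ φ ∈ A₂'} ≤ P.real A₂'' + P.real bad := by
    refine (measureReal_mono (fun φ hφ => ?_)).trans (measureReal_union_le _ _)
    by_cases hb : φ ∈ bad
    · exact Or.inr hb
    · exact Or.inl (hstep' (ψ φ) φ (fun x => by rw [abs_sub_comm]; exact hclose φ hb x) hφ)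
  have h3 : P.real A₁ ≤ 1 := measureReal_le_one
  have h4 : P.real A₁ * P.real {φ | ψ φ ∈ A₂'} ≤ P.real A₁ * (P.real A₂'' + P.real bad) := by
    gcongr
  have h5 : P.real A₁ * P.real bad ≤ 1 * P.real bad := by gcongr
  rw [hprod] at h1
  linarith

/-! ### Cubes and their shells -/

/-- The cube `y + [-L₀, 2L₀)^d`. -/
def cube {d : ℕ} (L₀ : ℕ) (y : Lat d) : Finset (Lat d) :=
  Fintype.piFinset fun i => Finset.Ico (y i - L₀) (y i + 2 * L₀)

/-- The face of the cube where coordinate `i` equals `a`. -/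
def cubeFace {d : ℕ} (L₀ : ℕ) (y : Lat d) (i : Fin d) (a : ℤ) : Finset (Lat d) :=
  Fintype.piFinset fun j => if j = i then {a} else Finset.Ico (y j - L₀) (y j + 2 * L₀)

/-- The union of the faces of the cube. -/
def shell {d : ℕ} (L₀ : ℕ) (y : Lat d) : Finset (Lat d) :=
  Finset.univ.biUnion fun i : Fin d =>
    cubeFace L₀ y i (y i - L₀) ∪ cubeFace L₀ y i (y i + 2 * L₀ - 1)

lemma mem_cube {d : ℕ} {L₀ : ℕ} {y z : Lat d} :
    z ∈ cube L₀ y ↔ ∀ i, y i - L₀ ≤ z i ∧ z i < y i + 2 * L₀ := by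
  simp [cube]

lemma card_cube {d : ℕ} (L₀ : ℕ) (y : Lat d) : (cube L₀ y).card = (3 * L₀) ^ d := by
  have : ∀ i, (Finset.Ico (y i - L₀) (y i + 2 * L₀)).card = 3 * L₀ := fun i => by
    rw [Int.card_Ico]; omega
  simp [cube, Fintype.card_piFinset, this]

lemma card_cubeFace {d : ℕ} (L₀ : ℕ) (y : Lat d) (i : Fin d) (a : ℤ) :
    (cubeFace L₀ y i a).card = (3 * L₀) ^ (d - 1) := by
  have : ∀ j, (if j = i then {a} else Finset.Ico (y j - L₀) (y j + 2 * L₀)).card =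
      if j = i then 1 else 3 * L₀ := fun j => by
    split_ifs
    · simp
    · rw [Int.card_Ico]; omega
  rw [cubeFace, Fintype.card_piFinset]
  simp only [this, Finset.prod_ite, Finset.prod_const_one, one_mul, Finset.prod_const]
  congr 1
  rw [Finset.filter_ne', Finset.card_erase_of_mem (Finset.mem_univ _), Finset.card_univ,
    Fintype.card_fin]

lemma card_shell_le {d : ℕ} (L₀ : ℕ) (y : Lat d) :
    (shell L₀ y).card ≤ d * (2 * (3 * L₀) ^ (d - 1)) := by
  refine (Finset.card_biUnion_le_card_mul _ _ (2 * (3 * L₀) ^ (d - 1)) fun i _ => ?_).trans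
    (by simp)
  refine (Finset.card_union_le _ _).trans ?_
  rw [card_cubeFace, card_cubeFace]
  omega

lemma shell_subset_cube {d : ℕ} {L₀ : ℕ} (hL : 1 ≤ L₀) (y : Lat d) : shell L₀ y ⊆ cube L₀ y := by
  intro z hz
  simp only [shell, cubeFace, Finset.mem_biUnion, Finset.mem_union, Fintype.mem_piFinset,
    Finset.mem_univ, true_and] at hz
  obtain ⟨i, hz⟩ := hz
  rw [mem_cube]
  intro j
  rcases hz with hz | hz
  all_goals
    have := hz j
    split_ifs at this with hj
    · subst hj
      simp only [Finset.mem_singleton] at this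
      omega
    · simpa using this

lemma neighbor_mem_cube {d : ℕ} {L₀ : ℕ} {y z : Lat d} (hz : z ∈ cube L₀ y)
    (hz' : z ∉ shell L₀ y) (i : Fin d) :
    z + Pi.single i 1 ∈ cube L₀ y ∧ z - Pi.single i 1 ∈ cube L₀ y := by
  rw [mem_cube] at hz
  simp only [shell, cubeFace, Finset.mem_biUnion, Finset.mem_union, Fintype.mem_piFinset,
    Finset.mem_univ, true_and, not_exists, not_or] at hz'
  have hface : ∀ a, (¬∀ j, z j ∈ if j = i then {a} else
      Finset.Ico (y j - (L₀ : ℤ)) (y j + 2 * (L₀ : ℤ))) → z i ≠ a := by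
    intro a ha heq
    refine ha fun j => ?_
    split_ifs with hj
    · subst hj; simp [heq]
    · simpa using hz j
  have h1 := hface _ (hz' i).1
  have h2 := hface _ (hz' i).2
  simp only [mem_cube]
  constructor <;> intro j <;> have hj := hz j <;> by_cases hji : j = i
  · subst hji; simp only [Pi.add_apply, Pi.single_eq_same]; omega
  · simpa [Pi.single_eq_of_ne hji] using hj
  · subst hji; simp only [Pi.sub_apply, Pi.single_eq_same]; omega
  · simpa [Pi.single_eq_of_ne hji] using hj

lemma dist_le_of_mem_cube {d : ℕ} {L₀ : ℕ} {y z : Lat d} (hz : z ∈ cube L₀ y) :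
    dist z y ≤ 2 * L₀ := by
  rw [mem_cube] at hz
  rw [dist_pi_le_iff (by positivity)]
  intro i
  rw [Int.dist_eq, abs_le]
  obtain ⟨h1, h2⟩ := hz i
  have h1' : (y i : ℝ) - L₀ ≤ z i := by exact_mod_cast h1
  have h2' : (z i : ℝ) < y i + 2 * L₀ := by exact_mod_cast h2
  have h3 : (0 : ℝ) ≤ L₀ := by positivity
  constructor <;> linarith

/-! ### Boxes -/

lemma scale_succ (L₀ l₀ n : ℕ) : scale L₀ l₀ (n + 1) = l₀ * scale L₀ l₀ n := by
  simp only [scale, pow_succ]; ring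

lemma one_le_scale {L₀ l₀ : ℕ} (hL : 1 ≤ L₀) (hl : 100 ≤ l₀) (n : ℕ) : 1 ≤ scale L₀ l₀ n :=
  Nat.mul_pos (Nat.pow_pos (by omega)) hL

lemma hundred_mul_scale_le {L₀ l₀ : ℕ} (hl : 100 ≤ l₀) (n : ℕ) :
    (100 : ℝ) * scale L₀ l₀ n ≤ scale L₀ l₀ (n + 1) := by
  rw [scale_succ]
  exact_mod_cast Nat.mul_le_mul_right _ hl

lemma le_scale {L₀ l₀ : ℕ} (hl : 100 ≤ l₀) (n : ℕ) : L₀ ≤ scale L₀ l₀ n :=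
  Nat.le_mul_of_pos_left _ (Nat.pow_pos (by omega))

lemma self_mem_box {d : ℕ} {L₀ l₀ : ℕ} (hL : 1 ≤ L₀) (hl : 100 ≤ l₀) (n : ℕ) (x : Lat d) :
    x ∈ box L₀ l₀ n x := by
  intro i
  have := one_le_scale hL hl n
  omega

lemma dist_le_of_mem_box {d : ℕ} {L₀ l₀ n : ℕ} {x z : Lat d} (hz : z ∈ box L₀ l₀ n x) :
    dist z x ≤ scale L₀ l₀ n := by
  rw [dist_pi_le_iff (by positivity)]
  intro i
  rw [Int.dist_eq, abs_le]
  obtain ⟨h1, h2⟩ := hz i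
  have h1' : (x i : ℝ) ≤ z i := by exact_mod_cast h1
  have h2' : (z i : ℝ) < x i + scale L₀ l₀ n := by exact_mod_cast h2
  have h3 : (0 : ℝ) ≤ scale L₀ l₀ n := by positivity
  constructor <;> linarith

lemma setDist_le_dist {d : ℕ} {K U : Set (Lat d)} {x y : Lat d} (hx : x ∈ K) (hy : y ∈ U) :
    setDist K U ≤ dist x y := by
  refine csInf_le ⟨0, ?_⟩ ⟨x, hx, y, hy, rfl⟩
  rintro r ⟨a, _, b, _, rfl⟩
  exact dist_nonneg

lemma exists_dist_lt_of_setDist_lt {d : ℕ} {K U : Set (Lat d)} (hK : K.Nonempty)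
    (hU : U.Nonempty) {r : ℝ} (h : setDist K U < r) : ∃ x ∈ K, ∃ y ∈ U, dist x y < r := by
  obtain ⟨a, ha⟩ := hK
  obtain ⟨b, hb⟩ := hU
  have hne : {r : ℝ | ∃ x ∈ K, ∃ y ∈ U, r = dist x y}.Nonempty := ⟨_, a, ha, b, hb, rfl⟩
  obtain ⟨_, ⟨x, hx, y, hy, rfl⟩, hlt⟩ := exists_lt_of_csInf_lt hne h
  exact ⟨x, hx, y, hy, hlt⟩

/-- Distances between lattice points are integers, so a distance below `2` is at most `1`. -/
lemma bigBox_subset_cube {d : ℕ} {L₀ l₀ : ℕ} (hL : 1 ≤ L₀) (hl : 100 ≤ l₀) (x : Lat d) :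
    bigBox L₀ l₀ 0 x ⊆ cube L₀ x := by
  intro z hz
  simp only [bigBox, mem_iUnion] at hz
  obtain ⟨y, ⟨_, hy⟩, hzy⟩ := hz
  obtain ⟨u, hu, v, hv, huv⟩ := exists_dist_lt_of_setDist_lt ⟨y, self_mem_box hL hl 0 y⟩
    ⟨x, self_mem_box hL hl 0 x⟩ (lt_of_le_of_lt hy one_lt_two)
  rw [Finset.mem_coe, mem_cube]
  intro i
  have h1 := (dist_le_pi_dist u v i).trans_lt huv
  rw [Int.dist_eq] at h1
  have h2 : |u i - v i| < 2 := by exact_mod_cast h1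
  rw [abs_lt] at h2
  have h3 := hu i
  have h4 := hv i
  have h5 := hzy i
  simp only [scale, pow_zero, one_mul] at h3 h4 h5
  omega

/-! ### Descendants and trees -/

lemma mem_box_of_mem_desc₁ {d : ℕ} {L₀ l₀ k : ℕ} (hL : 1 ≤ L₀) (hl : 100 ≤ l₀) {x y : Lat d}
    (h : (k, y) ∈ desc₁ L₀ l₀ k x) : y ∈ box L₀ l₀ (k + 1) x :=
  h.2.1 (self_mem_box hL hl k y)

lemma dist_le_of_mem_desc₂ {d : ℕ} {L₀ l₀ k : ℕ} (hL : 1 ≤ L₀) (hl : 100 ≤ l₀) {x y : Lat d}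
    (h : (k, y) ∈ desc₂ L₀ l₀ k x) : dist y x ≤ 2 * scale L₀ l₀ (k + 1) := by
  obtain ⟨_, z, hz, hz'⟩ := h
  have hz'' : setDist {z} (box L₀ l₀ (k + 1) x) = ((scale L₀ l₀ (k + 1) / 2 : ℕ) : ℝ) := hz'
  obtain ⟨z', hz1, b, hb, hlt⟩ := exists_dist_lt_of_setDist_lt (singleton_nonempty z)
    ⟨x, self_mem_box hL hl (k + 1) x⟩ (hz''.trans_lt (lt_add_one _))
  obtain rfl : z' = z := hz1
  have h1 := dist_le_of_mem_box hz
  have h2 := dist_le_of_mem_box hb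
  have h3 : ((scale L₀ l₀ (k + 1) / 2 : ℕ) : ℝ) ≤ scale L₀ l₀ (k + 1) / 2 := Nat.cast_div_le
  have h4 := hundred_mul_scale_le (L₀ := L₀) hl k
  have h5 : (1 : ℝ) ≤ scale L₀ l₀ k := by exact_mod_cast one_le_scale hL hl k
  have h6 := dist_triangle4 y z' b x
  rw [dist_comm y z'] at h6
  linarith

/-- The `1` absorbs the integer part in `desc₂`; `scale L₀ l₀ k` absorbs the passage from a point of
the box to its label. -/
lemma desc_dist_ge {d : ℕ} {L₀ l₀ k : ℕ} (hL : 1 ≤ L₀) (hl : 100 ≤ l₀) {x y₁ y₂ : Lat d}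
    (h₁ : (k, y₁) ∈ desc₁ L₀ l₀ k x) (h₂ : (k, y₂) ∈ desc₂ L₀ l₀ k x) :
    (scale L₀ l₀ (k + 1) : ℝ) / 2 - 1 - scale L₀ l₀ k ≤ dist y₂ y₁ := by
  obtain ⟨_, z, hz, hz'⟩ := h₂
  have hz'' : setDist {z} (box L₀ l₀ (k + 1) x) = ((scale L₀ l₀ (k + 1) / 2 : ℕ) : ℝ) := hz'
  have h1 := setDist_le_dist (mem_singleton z) (mem_box_of_mem_desc₁ hL hl h₁)
  rw [hz''] at h1
  have h2 := dist_le_of_mem_box hz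
  have h3 : (scale L₀ l₀ (k + 1) : ℝ) / 2 - 1 ≤ ((scale L₀ l₀ (k + 1) / 2 : ℕ) : ℝ) := by
    have : scale L₀ l₀ (k + 1) ≤ 2 * (scale L₀ l₀ (k + 1) / 2) + 1 := by omega
    have : (scale L₀ l₀ (k + 1) : ℝ) ≤ 2 * ((scale L₀ l₀ (k + 1) / 2 : ℕ) : ℝ) + 1 := by
      exact_mod_cast this
    linarith
  have h4 := dist_triangle z y₂ y₁
  linarith

lemma tree_mem_renLat {d : ℕ} {L₀ l₀ n k : ℕ} {x y : Lat d} {T : Set (ℕ × Lat d)}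
    (hT : T ∈ trees L₀ l₀ n x) (hy : (k, y) ∈ T) : k ≤ n ∧ y ∈ renLat d L₀ l₀ k := by
  have := hT.1 hy
  simp only [mem_iUnion] at this
  obtain ⟨j, hj, rfl, h⟩ := this
  exact ⟨hj, h⟩

/-- The generations of a dyadic tree are finite, of dyadic cardinality, and close to the root. -/
lemma tree_generation {d : ℕ} {L₀ l₀ n : ℕ} (hL : 1 ≤ L₀) (hl : 100 ≤ l₀) {x : Lat d}
    {T : Set (ℕ × Lat d)} (hT : T ∈ trees L₀ l₀ n x) (j k : ℕ) (hjk : k + j = n) :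
    ∃ F : Finset (Lat d), (∀ y, y ∈ F ↔ (k, y) ∈ T) ∧ F.card ≤ 2 ^ j ∧
      ∀ y ∈ F, dist y x ≤ 3 * scale L₀ l₀ n - 3 * scale L₀ l₀ k := by
  classical
  induction j generalizing k with
  | zero =>
    obtain rfl : k = n := by omega
    refine ⟨{x}, fun y => ?_, by simp, fun y hy => ?_⟩
    · have h1 : (k, y) ∈ T ↔ (k, y) ∈ T ∩ labels d L₀ l₀ k :=
        ⟨fun h => ⟨h, rfl, (tree_mem_renLat hT h).2⟩, fun h => h.1⟩
      rw [h1, hT.2.1]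
      simp
    · rw [Finset.mem_singleton.1 hy]; simp
  | succ j ih =>
    obtain ⟨F, hF, hcard, hdist⟩ := ih (k + 1) (by omega)
    obtain ⟨y₁, y₂, hdesc⟩ := hT.2.2
    obtain ⟨hd1, hd2⟩ := hdesc k (by omega)
    refine ⟨F.biUnion fun y => {y₁ (k + 1) y, y₂ (k + 1) y}, fun y => ?_, ?_, fun y hy => ?_⟩
    · have h1 : (k, y) ∈ T ↔ (k, y) ∈ T ∩ labels d L₀ l₀ k :=
        ⟨fun h => ⟨h, rfl, (tree_mem_renLat hT h).2⟩, fun h => h.1⟩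
      rw [h1, hd2]
      simp [hF]
    · refine (Finset.card_biUnion_le_card_mul _ _ 2 fun _ _ => Finset.card_le_two).trans ?_
      rw [pow_succ]
      gcongr
    · obtain ⟨y', hy', hyy'⟩ := Finset.mem_biUnion.1 hy
      have hp := hdist y' hy'
      obtain ⟨p1, p2⟩ := hd1 y' ((hF y').1 hy')
      have h4 := hundred_mul_scale_le (L₀ := L₀) hl k
      -- Since `2 * L_{k+1} ≤ 3 * L_{k+1} - 3 * L_k`, the steps telescope to the claimed radius.
      have hstep : dist y y' ≤ 2 * scale L₀ l₀ (k + 1) := by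
        simp only [Finset.mem_insert, Finset.mem_singleton] at hyy'
        rcases hyy' with rfl | rfl
        · have := dist_le_of_mem_box (mem_box_of_mem_desc₁ hL hl p1)
          have h0 : (0 : ℝ) ≤ scale L₀ l₀ (k + 1) := by positivity
          linarith
        · exact dist_le_of_mem_desc₂ hL hl p2
      have h5 := dist_triangle y y' x
      have h0 : (0 : ℝ) ≤ scale L₀ l₀ k := by positivity
      linarith

/-- The labels reachable from a root by passing to descendants. -/
inductive Reach {d : ℕ} (y₁ y₂ : ℕ → Lat d → Lat d) (r : ℕ × Lat d) : ℕ × Lat d → Prop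
  | root : Reach y₁ y₂ r r
  | left {k : ℕ} {y : Lat d} : Reach y₁ y₂ r (k + 1, y) → Reach y₁ y₂ r (k, y₁ (k + 1) y)
  | right {k : ℕ} {y : Lat d} : Reach y₁ y₂ r (k + 1, y) → Reach y₁ y₂ r (k, y₂ (k + 1) y)

lemma Reach.level_le {d : ℕ} {y₁ y₂ : ℕ → Lat d → Lat d} {r p : ℕ × Lat d}
    (h : Reach y₁ y₂ r p) : p.1 ≤ r.1 := by
  induction h with
  | root => exact le_rfl
  | left _ ih => exact (Nat.le_succ _).trans ih
  | right _ ih => exact (Nat.le_succ _).trans ih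

lemma Reach.eq_or_exists {d : ℕ} {y₁ y₂ : ℕ → Lat d → Lat d} {r p : ℕ × Lat d}
    (h : Reach y₁ y₂ r p) : p = r ∨ ∃ y, Reach y₁ y₂ r (p.1 + 1, y) ∧
      (p.2 = y₁ (p.1 + 1) y ∨ p.2 = y₂ (p.1 + 1) y) := by
  cases h with
  | root => exact Or.inl rfl
  | left h => exact Or.inr ⟨_, h, Or.inl rfl⟩
  | right h => exact Or.inr ⟨_, h, Or.inr rfl⟩

/-- A dyadic tree of depth `n + 1` splits into two subtrees of depth `n`. -/
lemma tree_split {d : ℕ} {L₀ l₀ n : ℕ} {x : Lat d} {T : Set (ℕ × Lat d)}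
    (hT : T ∈ trees L₀ l₀ (n + 1) x) :
    ∃ r₁ r₂ : Lat d, (n, r₁) ∈ desc₁ L₀ l₀ n x ∧ (n, r₂) ∈ desc₂ L₀ l₀ n x ∧
      ∃ T₁ ∈ trees L₀ l₀ n r₁, ∃ T₂ ∈ trees L₀ l₀ n r₂,
        ∀ y, (0, y) ∈ T ↔ (0, y) ∈ T₁ ∨ (0, y) ∈ T₂ := by
  obtain ⟨y₁, y₂, hdesc⟩ := hT.2.2
  have hlab : ∀ {k y}, (k, y) ∈ T → (k, y) ∈ labels d L₀ l₀ k := fun h =>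
    ⟨rfl, (tree_mem_renLat hT h).2⟩
  have hmem : ∀ k < n + 1, ∀ y, (k, y) ∈ T ↔
      ∃ y', (k + 1, y') ∈ T ∧ (y = y₁ (k + 1) y' ∨ y = y₂ (k + 1) y') := by
    intro k hk y
    have h1 : (k, y) ∈ T ↔ (k, y) ∈ T ∩ labels d L₀ l₀ k :=
      ⟨fun h => ⟨h, hlab h⟩, fun h => h.1⟩
    rw [h1, (hdesc k hk).2]
    simp
  have hroot : ∀ y, (n + 1, y) ∈ T ↔ y = x := by
    intro y
    have h1 : (n + 1, y) ∈ T ↔ (n + 1, y) ∈ T ∩ labels d L₀ l₀ (n + 1) :=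
      ⟨fun h => ⟨h, hlab h⟩, fun h => h.1⟩
    rw [h1, hT.2.1]
    simp
  have hsub : ∀ r, (n, r) ∈ T → ∀ p, Reach y₁ y₂ (n, r) p → p ∈ T := by
    intro r hr p hp
    induction hp with
    | root => exact hr
    | @left k y h ih =>
      have hk : k + 1 ≤ n := h.level_le
      exact (hmem k (by omega) _).2 ⟨y, ih, Or.inl rfl⟩
    | @right k y h ih =>
      have hk : k + 1 ≤ n := h.level_le
      exact (hmem k (by omega) _).2 ⟨y, ih, Or.inr rfl⟩
  -- The choice functions of `T` also serve each subtree. The two subtrees may overlap; only the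
  -- union of their leaves matters.
  have htree : ∀ r, (n, r) ∈ T → {p | Reach y₁ y₂ (n, r) p} ∈ trees L₀ l₀ n r := by
    intro r hr
    refine ⟨?_, ?_, y₁, y₂, fun k hk => ⟨fun y hy => ?_, ?_⟩⟩
    · rintro ⟨k, y⟩ hp
      simp only [mem_iUnion]
      exact ⟨k, hp.level_le, hlab (hsub r hr _ hp)⟩
    · ext ⟨k, y⟩
      constructor
      · rintro ⟨hp, hk, _⟩
        rcases hp.eq_or_exists with h | ⟨z, hz, _⟩
        · exact h
        · have h1 : k + 1 ≤ n := hz.level_le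
          have h2 : k = n := hk
          omega
      · intro h
        obtain ⟨rfl, rfl⟩ := Prod.mk.inj (h : (k, y) = (n, r))
        exact ⟨Reach.root, hlab hr⟩
    · exact (hdesc k (by omega)).1 y (hsub r hr _ hy)
    · ext ⟨j, y⟩
      simp only [mem_inter_iff, mem_iUnion, mem_insert_iff, mem_singleton_iff, Prod.mk.injEq]
      constructor
      · rintro ⟨hp, hj, _⟩
        obtain rfl : j = k := hj
        rcases hp.eq_or_exists with h | ⟨z, hz, hyz⟩
        · have : j = n := congrArg Prod.fst h
          omega
        · exact ⟨z, hz, hyz.imp (fun h => ⟨rfl, h⟩) fun h => ⟨rfl, h⟩⟩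
      · rintro ⟨z, hz, ⟨rfl, rfl⟩ | ⟨rfl, rfl⟩⟩
        · exact ⟨Reach.left hz, hlab (hsub r hr _ (Reach.left hz))⟩
        · exact ⟨Reach.right hz, hlab (hsub r hr _ (Reach.right hz))⟩
  have hx : (n + 1, x) ∈ T := (hroot x).2 rfl
  have h1 : (n, y₁ (n + 1) x) ∈ T := (hmem n (by omega) _).2 ⟨x, hx, Or.inl rfl⟩
  have h2 : (n, y₂ (n + 1) x) ∈ T := (hmem n (by omega) _).2 ⟨x, hx, Or.inr rfl⟩
  have hcover : ∀ j k, k + j = n → ∀ y, (k, y) ∈ T →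
      Reach y₁ y₂ (n, y₁ (n + 1) x) (k, y) ∨ Reach y₁ y₂ (n, y₂ (n + 1) x) (k, y) := by
    intro j
    induction j with
    | zero =>
      intro k hk y hy
      obtain rfl : k = n := hk
      obtain ⟨z, hz, hyz⟩ := (hmem k (by omega) y).1 hy
      obtain rfl := (hroot z).1 hz
      rcases hyz with rfl | rfl
      · exact Or.inl Reach.root
      · exact Or.inr Reach.root
    | succ j ih =>
      intro k hk y hy
      obtain ⟨z, hz, hyz⟩ := (hmem k (by omega) y).1 hy
      have := ih (k + 1) (by omega) z hz
      rcases hyz with rfl | rfl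
      · exact this.imp Reach.left Reach.left
      · exact this.imp Reach.right Reach.right
  refine ⟨y₁ (n + 1) x, y₂ (n + 1) x, ((hdesc n (by omega)).1 x hx).1,
    ((hdesc n (by omega)).1 x hx).2, _, htree _ h1, _, htree _ h2, fun y => ⟨?_, ?_⟩⟩
  · exact hcover n 0 (by omega) y
  · rintro (h | h)
    · exact hsub _ h1 _ h
    · exact hsub _ h2 _ h

/-! ### Tree events -/

lemma localOn_of_measurableSet_coordSigma {d : ℕ} {K : Set (Lat d)} {A : Set (Config d)}
    (hA : MeasurableSet[coordSigma K] A) : LocalOn K A := by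
  -- Sets pulled back by restriction to `K` are automatically local, so comparison with that
  -- σ-algebra suffices.
  have hle : coordSigma K ≤ MeasurableSpace.comap (fun (ω : Config d) (z : K) => ω z) ⊤ := by
    refine iSup₂_le fun z hz => ?_
    rintro _ ⟨B, _, rfl⟩
    exact ⟨(fun v : K → Bool => v ⟨z, hz⟩) ⁻¹' B, trivial, rfl⟩
  obtain ⟨B, _, rfl⟩ := hle A hA
  intro ω ω' h hω
  have : (fun z : K => ω z) = fun z : K => ω' z := funext fun z => h z z.2
  simpa only [mem_preimage, this] using hω

lemma measurableSet_of_coordSigma {d : ℕ} {K : Set (Lat d)} {A : Set (Config d)}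
    (hA : MeasurableSet[coordSigma K] A) : MeasurableSet A := by
  have hle : coordSigma K ≤ MeasurableSpace.pi := by
    refine iSup₂_le fun z _ => ?_
    exact le_iSup (fun z => MeasurableSpace.comap (fun ω : Config d => ω z) ⊤) z
  exact hle A hA

lemma measurable_threshold {d : ℕ} (h : ℝ) : Measurable (threshold (d := d) h) := by
  refine measurable_pi_lambda _ fun x => measurable_to_bool ?_
  have : (fun φ : Lat d → ℝ => threshold h φ x) ⁻¹' {true} = {φ | h ≤ φ x} := by
    ext φ; simp [threshold]
  rw [this]
  exact measurableSet_le measurable_const (measurable_pi_apply x)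

lemma measurableSet_treeEvent {d : ℕ} {D : Lat d → Set (Config d)} {T : Set (ℕ × Lat d)}
    {F : Finset (Lat d)} (hF : ∀ y, y ∈ F ↔ (0, y) ∈ T) (hD : ∀ y ∈ F, MeasurableSet (D y))
    (h : ℝ) : MeasurableSet (treeEvent D T h) := by
  have : {y : Lat d | (0, y) ∈ T} = F := by ext y; simp [hF]
  rw [treeEvent, this]
  exact F.measurableSet_biInter fun y hy => measurable_threshold h (hD y hy)

lemma localOn_treeEvent {d : ℕ} {D : Lat d → Set (Config d)} {T : Set (ℕ × Lat d)}
    {K : Set (Lat d)} (hD : ∀ y, (0, y) ∈ T → LocalOn K (D y)) (h : ℝ) :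
    LocalOn K (treeEvent D T h) := by
  intro φ φ' hφ hA
  simp only [treeEvent, mem_iInter, mem_preimage] at hA ⊢
  exact fun y hy => hD y hy _ _ (fun x hx => by simp [threshold, hφ x hx]) (hA y hy)

lemma treeEvent_sub_of_isUpperSet {d : ℕ} {D : Lat d → Set (Config d)} {T : Set (ℕ × Lat d)}
    (hD : ∀ y, (0, y) ∈ T → IsUpperSet (D y)) {h γ : ℝ} {φ φ' : Lat d → ℝ}
    (hφ : ∀ x, |φ x - φ' x| ≤ γ) (hA : φ ∈ treeEvent D T h) : φ' ∈ treeEvent D T (h - γ) := by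
  simp only [treeEvent, mem_iInter, mem_preimage] at hA ⊢
  refine fun y hy => hD y hy (fun x => ?_) (hA y hy)
  simp only [threshold, Bool.le_iff_imp, decide_eq_true_eq]
  intro hx
  have := (abs_le.1 (hφ x)).2
  linarith

lemma treeEvent_add_of_isLowerSet {d : ℕ} {D : Lat d → Set (Config d)} {T : Set (ℕ × Lat d)}
    (hD : ∀ y, (0, y) ∈ T → IsLowerSet (D y)) {h γ : ℝ} {φ φ' : Lat d → ℝ}
    (hφ : ∀ x, |φ x - φ' x| ≤ γ) (hA : φ ∈ treeEvent D T h) : φ' ∈ treeEvent D T (h + γ) := by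
  simp only [treeEvent, mem_iInter, mem_preimage] at hA ⊢
  refine fun y hy => hD y hy (fun x => ?_) (hA y hy)
  simp only [threshold, Bool.le_iff_imp, decide_eq_true_eq]
  intro hx
  have := (abs_le.1 (hφ x)).1
  linarith

lemma measureReal_treeEvent_le_q {d : ℕ} {P : Measure (Lat d → ℝ)} [IsProbabilityMeasure P]
    {L₀ l₀ n : ℕ} {D : Lat d → Set (Config d)} {x : Lat d} {T : Set (ℕ × Lat d)}
    (hx : x ∈ renLat d L₀ l₀ n) (hT : T ∈ trees L₀ l₀ n x) (h : ℝ) :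
    P.real (treeEvent D T h) ≤ q P L₀ l₀ D n h := by
  refine le_csSup ⟨1, ?_⟩ ⟨x, hx, T, hT, rfl⟩
  rintro _ ⟨_, _, _, _, rfl⟩
  exact measureReal_le_one

/-! ### The numerical bounds -/

/-- The constant in the variance bound for the predictor. -/
def varConst (d : ℕ) (C : ℝ) : ℝ := 4 * d * 3 ^ (d - 1) * C ^ 2 * 16 ^ (d - 2)

/-- The hypothesis on `s` is the size of a union of `2 ^ n` shells. The factors `2 ^ n` and `L₀ ^ (d
- 1)` are absorbed by the squares of `2 ^ (n + 1)` and of `L₀ ^ (d - 2)`. -/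
lemma variance_bound {d : ℕ} (hd : 3 ≤ d) {C : ℝ} {L₀ l₀ n s : ℕ} (hL : 1 ≤ L₀) (hl : 100 ≤ l₀)
    (hs : s ≤ 2 ^ n * (d * (2 * (3 * L₀) ^ (d - 1)))) :
    2 * (s * (C * (((scale L₀ l₀ (n + 1) : ℝ) / 4) ^ (d - 2))⁻¹) ^ 2) ≤
      varConst d C * ((2 * (l₀ : ℝ) ^ (-((d : ℤ) - 2))) ^ (n + 1)) ^ 2 := by
  obtain ⟨m, rfl⟩ : ∃ m, d = m + 3 := ⟨d - 3, by omega⟩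
  have hL' : (1 : ℝ) ≤ L₀ := by exact_mod_cast hL
  have hl' : (0 : ℝ) < l₀ := by exact_mod_cast (by omega : 0 < l₀)
  have e1 : m + 3 - 1 = m + 2 := rfl
  have e2 : m + 3 - 2 = m + 1 := rfl
  have e3 : -(((m + 3 : ℕ) : ℤ) - 2) = -((m + 1 : ℕ) : ℤ) := by push_cast; ring
  rw [e1] at hs
  rw [varConst, e1, e2, e3, zpow_neg, zpow_natCast]
  have hs' : (s : ℝ) ≤ 2 ^ n * (((m + 3 : ℕ) : ℝ) * (2 * (3 * L₀) ^ (m + 2))) := by exact_mod_cast hs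
  have hpow : (2 : ℝ) ^ n ≤ (2 ^ (n + 1)) ^ 2 := by
    rw [← pow_mul]
    exact pow_le_pow_right₀ one_le_two (by omega)
  -- This is `d - 1 ≤ 2 * (d - 2)`, that is, `d ≥ 3`.
  have hLL : (L₀ : ℝ) ^ (m + 2) ≤ (L₀ ^ (m + 1)) ^ 2 := by
    rw [← pow_mul]
    exact pow_le_pow_right₀ hL' (by omega)
  have hscale : (scale L₀ l₀ (n + 1) : ℝ) = l₀ ^ (n + 1) * L₀ := by simp [scale]
  set Q : ℝ := (C * (((scale L₀ l₀ (n + 1) : ℝ) / 4) ^ (m + 1))⁻¹) ^ 2 with hQ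
  have hQ0 : 0 ≤ Q := sq_nonneg _
  have hQ' : Q * (L₀ ^ (m + 1)) ^ 2 =
      C ^ 2 * 16 ^ (m + 1) * (((l₀ : ℝ) ^ (n + 1)) ^ (m + 1))⁻¹ ^ 2 := by
    rw [hQ, hscale]
    have : (16 : ℝ) ^ (m + 1) = (4 ^ (m + 1)) ^ 2 := by
      rw [← pow_mul, mul_comm, pow_mul]; norm_num
    rw [this, div_pow]
    field_simp
    ring
  calc 2 * (s * Q) ≤ 2 * ((2 ^ n * (((m + 3 : ℕ) : ℝ) * (2 * (3 * L₀) ^ (m + 2)))) * Q) := by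
        gcongr
    _ = 4 * ((m + 3 : ℕ) : ℝ) * 3 ^ (m + 2) * Q * (2 ^ n * L₀ ^ (m + 2)) := by
        rw [mul_pow]; ring
    _ ≤ 4 * ((m + 3 : ℕ) : ℝ) * 3 ^ (m + 2) * Q * ((2 ^ (n + 1)) ^ 2 * (L₀ ^ (m + 1)) ^ 2) := by
        gcongr
    _ = 4 * ((m + 3 : ℕ) : ℝ) * 3 ^ (m + 2) * (Q * (L₀ ^ (m + 1)) ^ 2) * (2 ^ (n + 1)) ^ 2 := by
        ring
    _ = _ := by
        rw [hQ', mul_pow 2, inv_pow (_ ^ (m + 1)) (n + 1), ← pow_mul, ← pow_mul (l₀ : ℝ) (m + 1),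
          mul_comm (m + 1)]
        ring

lemma tail_bound {d L₀ n k : ℕ} (hd : 3 ≤ d) (hL : 1 ≤ L₀) (hk : k ≤ 2 ^ n * (3 * L₀) ^ d)
    {β : ℝ} (hβ : M (Real.sqrt 2) d n L₀ ≤ β) :
    2 * (k * (2 * Real.exp (-β ^ 2))) ≤ 3 * Real.exp (-(β - M (Real.sqrt 2) d n L₀) ^ 2) := by
  set N : ℝ := 2 ^ n * (3 * (L₀ : ℝ)) ^ d with hN
  set m := M (Real.sqrt 2) d n L₀ with hm
  have hL' : (1 : ℝ) ≤ L₀ := by exact_mod_cast hL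
  have hN4 : 4 ≤ N := by
    have h1 : (1 : ℝ) ≤ 2 ^ n := one_le_pow₀ one_le_two
    have h2 : (3 : ℝ) ^ 3 ≤ (3 * (L₀ : ℝ)) ^ d :=
      (pow_le_pow_right₀ (by norm_num) hd).trans (by gcongr; linarith)
    nlinarith
  have hN0 : 0 < N := by linarith
  have hkN : (k : ℝ) ≤ N := by rw [hN]; exact_mod_cast hk
  have hlog : 0 ≤ Real.log N := Real.log_nonneg (by linarith)
  have hm0 : 0 ≤ m := mul_nonneg (Real.sqrt_nonneg _) (Real.sqrt_nonneg _)
  have hmsq : m ^ 2 = 2 * Real.log N := by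
    rw [hm, M, mul_pow, Real.sq_sqrt (by norm_num), Real.sq_sqrt hlog]
  -- For `0 ≤ m ≤ β` one has `β ^ 2 ≥ (β - m) ^ 2 + m ^ 2`. The choice `c₂ = √2` makes `exp (-m ^ 2)
  -- = N⁻²`, which beats the `N` sites of the union bound.
  have hexp : Real.exp (-β ^ 2) ≤ Real.exp (-(β - m) ^ 2) * (N ^ 2)⁻¹ := by
    have : (N ^ 2)⁻¹ = Real.exp (-m ^ 2) := by
      rw [hmsq, Real.exp_neg, two_mul, Real.exp_add, Real.exp_log hN0, sq]
    rw [this, ← Real.exp_add]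
    apply Real.exp_le_exp.2
    nlinarith
  have hE := Real.exp_pos (-(β - m) ^ 2)
  calc 2 * (k * (2 * Real.exp (-β ^ 2)))
      ≤ 2 * (N * (2 * (Real.exp (-(β - m) ^ 2) * (N ^ 2)⁻¹))) := by gcongr
    _ = (4 / N) * Real.exp (-(β - m) ^ 2) := by field_simp; ring
    _ ≤ 3 * Real.exp (-(β - m) ^ 2) := by
        gcongr
        rw [div_le_iff₀ hN0]; linarith

/-! ### The recursion -/

/-- The recursion for `q`, for events that are stable, up to a change of level, under
perturbations of the field of size `γ`. -/
lemma IsGFF.q_succ_le {d : ℕ} (hd : 3 ≤ d) {C : ℝ} (hC : 0 < C)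
    (hgreen : ∀ (x y : Lat d) (r : ℝ), 0 < r → r ≤ dist x y →
      green d x y ≤ C * (r ^ (d - 2))⁻¹)
    {P : Measure (Lat d → ℝ)} (hP : IsGFF d P) {L₀ l₀ : ℕ} (hL : 1 ≤ L₀) (hl : 100 ≤ l₀)
    {D : Lat d → Set (Config d)}
    (hD : ∀ x ∈ renLat d L₀ l₀ 0, MeasurableSet[coordSigma (bigBox L₀ l₀ 0 x)] (D x))
    {n : ℕ} {β γ h h' h'' : ℝ} (hβ0 : 0 < β) (hβ : M (Real.sqrt 2) d n L₀ ≤ β)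
    (hγ : Real.sqrt (8 * varConst d C) * β * (2 * (l₀ : ℝ) ^ (-((d : ℤ) - 2))) ^ (n + 1) ≤ 2 * γ)
    (hstep : ∀ T : Set (ℕ × Lat d), (∀ y, (0, y) ∈ T → y ∈ renLat d L₀ l₀ 0) →
      ∀ φ φ' : Lat d → ℝ, (∀ x, |φ x - φ' x| ≤ γ) →
        φ ∈ treeEvent D T h → φ' ∈ treeEvent D T h')
    (hstep' : ∀ T : Set (ℕ × Lat d), (∀ y, (0, y) ∈ T → y ∈ renLat d L₀ l₀ 0) →
      ∀ φ φ' : Lat d → ℝ, (∀ x, |φ x - φ' x| ≤ γ) →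
        φ ∈ treeEvent D T h' → φ' ∈ treeEvent D T h'') :
    q P L₀ l₀ D (n + 1) h ≤
      q P L₀ l₀ D n h'' ^ 2 + 3 * Real.exp (-(β - M (Real.sqrt 2) d n L₀) ^ 2) := by
  classical
  have := hP.isProbabilityMeasure
  refine Real.sSup_le ?_ (by positivity)
  rintro _ ⟨x, hx, T, hT, rfl⟩
  obtain ⟨r₁, r₂, hr₁, hr₂, T₁, hT₁, T₂, hT₂, hleaf⟩ := tree_split hT
  have hr₁' : r₁ ∈ renLat d L₀ l₀ n := hr₁.1.2
  have hr₂' : r₂ ∈ renLat d L₀ l₀ n := hr₂.1.2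
  obtain ⟨F₁, hF₁, hcard₁, hdist₁⟩ := tree_generation hL hl hT₁ n 0 (by omega)
  obtain ⟨F₂, hF₂, hcard₂, hdist₂⟩ := tree_generation hL hl hT₂ n 0 (by omega)
  have hren₁ : ∀ y, (0, y) ∈ T₁ → y ∈ renLat d L₀ l₀ 0 := fun y hy => (tree_mem_renLat hT₁ hy).2
  have hren₂ : ∀ y, (0, y) ∈ T₂ → y ∈ renLat d L₀ l₀ 0 := fun y hy => (tree_mem_renLat hT₂ hy).2
  have hlocal : ∀ F : Finset (Lat d), ∀ y ∈ F, y ∈ renLat d L₀ l₀ 0 →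
      LocalOn (F.biUnion (cube L₀) : Finset (Lat d)) (D y) := by
    intro F y hy hyr ω ω' hω
    refine localOn_of_measurableSet_coordSigma (hD y hyr) ω ω' fun z hz => hω z ?_
    exact Finset.mem_coe.2 (Finset.mem_biUnion.2 ⟨y, hy, bigBox_subset_cube hL hl y hz⟩)
  set ε : ℝ := (2 * (l₀ : ℝ) ^ (-((d : ℤ) - 2))) ^ (n + 1) with hε
  have hl0 : (0 : ℝ) < l₀ := by exact_mod_cast (by omega : 0 < l₀)
  have hε0 : 0 < ε := by positivity
  have hd0 : (0 : ℝ) < d := by exact_mod_cast (by omega : 0 < d)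
  have hv0 : 0 < varConst d C := by unfold varConst; positivity
  have hγ0 : 0 < γ := by
    have : 0 < Real.sqrt (8 * varConst d C) * β * ε := by positivity
    linarith
  have hscale0 : (1 : ℝ) ≤ scale L₀ l₀ n := by exact_mod_cast one_le_scale hL hl n
  have hscale1 := hundred_mul_scale_le (L₀ := L₀) hl n
  have hLscale : (L₀ : ℝ) ≤ scale L₀ l₀ n := by exact_mod_cast le_scale hl n
  have hrad : ∀ (F : Finset (Lat d)) (r : Lat d),
      (∀ y ∈ F, dist y r ≤ 3 * scale L₀ l₀ n - 3 * scale L₀ l₀ 0) →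
      ∀ z ∈ F.biUnion (cube L₀), dist z r ≤ 5 * scale L₀ l₀ n := by
    intro F r hF z hz
    obtain ⟨y, hy, hzy⟩ := Finset.mem_biUnion.1 hz
    have h1 := dist_le_of_mem_cube hzy
    have h2 := hF y hy
    have h3 := dist_triangle z y r
    have h4 : (0 : ℝ) ≤ scale L₀ l₀ 0 := by positivity
    linarith
  -- Each union of cubes has radius at most `5 * L_n` about its root, and `11 * L_n + 1 ≤ L_{n+1} /
  -- 4`.
  have hfar : ∀ z₂ ∈ F₂.biUnion (cube L₀), ∀ z₁ ∈ F₁.biUnion (cube L₀),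
      (scale L₀ l₀ (n + 1) : ℝ) / 4 ≤ dist z₂ z₁ := by
    intro z₂ hz₂ z₁ hz₁
    have h1 := hrad F₁ r₁ hdist₁ z₁ hz₁
    have h2 := hrad F₂ r₂ hdist₂ z₂ hz₂
    have h3 := desc_dist_ge hL hl hr₁ hr₂
    have h4 := dist_triangle4 r₂ z₂ z₁ r₁
    rw [dist_comm r₂ z₂] at h4
    linarith
  have hr0 : (0 : ℝ) < (scale L₀ l₀ (n + 1) : ℝ) / 4 := by linarith
  have hshell : F₁.biUnion (shell L₀) ⊆ F₁.biUnion (cube L₀) :=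
    Finset.biUnion_mono fun y _ => shell_subset_cube hL y
  have hmeas : ∀ F : Finset (Lat d), (∀ y ∈ F, y ∈ renLat d L₀ l₀ 0) →
      ∀ y ∈ F, MeasurableSet (D y) := fun F hF y hy =>
    measurableSet_of_coordSigma (hD y (hF y hy))
  have hdec := hP.decoupling hd (K₁ := F₁.biUnion (cube L₀)) (S := F₁.biUnion (shell L₀))
    (K₂ := F₂.biUnion (cube L₀)) (D := C * (((scale L₀ l₀ (n + 1) : ℝ) / 4) ^ (d - 2))⁻¹)
    (V := varConst d C * ε ^ 2) (γ := γ) (A₁ := treeEvent D T₁ h) (A₂ := treeEvent D T₂ h)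
    (A₂' := treeEvent D T₂ h') (A₂'' := treeEvent D T₂ h'')
    (fun z hz hz' => by
      have := hfar z hz z hz'
      rw [dist_self] at this
      linarith)
    (fun z hz hzS i => by
      obtain ⟨y, hy, hzy⟩ := Finset.mem_biUnion.1 hz
      have := neighbor_mem_cube hzy (fun h => hzS (Finset.mem_biUnion.2 ⟨y, hy, h⟩)) i
      exact ⟨Finset.mem_biUnion.2 ⟨y, hy, this.1⟩, Finset.mem_biUnion.2 ⟨y, hy, this.2⟩⟩)
    (fun z hz z' hz' => hgreen z z' _ hr0 (hfar z hz z' (hshell hz')))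
    (variance_bound hd hL hl
      ((Finset.card_biUnion_le_card_mul _ _ _ fun y _ => card_shell_le L₀ y).trans
        (Nat.mul_le_mul_right _ hcard₁)))
    hγ0.le
    (measurableSet_treeEvent hF₁ (hmeas F₁ fun y hy => hren₁ y ((hF₁ y).1 hy)) h)
    (measurableSet_treeEvent hF₂ (hmeas F₂ fun y hy => hren₂ y ((hF₂ y).1 hy)) h')
    (localOn_treeEvent (fun y hy => hlocal F₁ y ((hF₁ y).2 hy) (hren₁ y hy)) h)
    (localOn_treeEvent (fun y hy => hlocal F₂ y ((hF₂ y).2 hy) (hren₂ y hy)) h')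
    (hstep T₂ hren₂) (hstep' T₂ hren₂)
  have hevent : treeEvent D T h = treeEvent D T₁ h ∩ treeEvent D T₂ h := by
    ext φ
    simp only [treeEvent, mem_inter_iff, mem_iInter, mem_ofPred_eq, hleaf, or_imp, forall_and]
  -- Used with equal fields, the two perturbation steps reduce to monotonicity of the event in the
  -- level.
  have hγabs : ∀ (φ : Lat d → ℝ) x, |φ x - φ x| ≤ γ := fun φ x => by simpa using hγ0.le
  have hA₁ : P.real (treeEvent D T₁ h) ≤ q P L₀ l₀ D n h'' :=
    (measureReal_mono fun φ hφ => hstep' T₁ hren₁ φ φ (hγabs φ)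
      (hstep T₁ hren₁ φ φ (hγabs φ) hφ)).trans (measureReal_treeEvent_le_q hr₁' hT₁ h'')
  have hA₂ : P.real (treeEvent D T₂ h'') ≤ q P L₀ l₀ D n h'' :=
    measureReal_treeEvent_le_q hr₂' hT₂ h''
  have hprod : P.real (treeEvent D T₁ h) * P.real (treeEvent D T₂ h'') ≤
      q P L₀ l₀ D n h'' ^ 2 := by
    rw [sq]
    exact mul_le_mul hA₁ hA₂ measureReal_nonneg (measureReal_nonneg.trans hA₁)
  -- The `8` in `c₁` gives `γ ^ 2 ≥ 2 * V * β ^ 2` with `V = varConst d C * ε ^ 2`.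
  have hexp : Real.exp (-γ ^ 2 / (2 * (varConst d C * ε ^ 2))) ≤ Real.exp (-β ^ 2) := by
    apply Real.exp_le_exp.2
    rw [div_le_iff₀ (by positivity)]
    have h1 : (Real.sqrt (8 * varConst d C) * β * ε) ^ 2 ≤ (2 * γ) ^ 2 := by gcongr
    rw [mul_pow, mul_pow, Real.sq_sqrt (by positivity)] at h1
    linarith
  have hcardK : (F₂.biUnion (cube L₀)).card ≤ 2 ^ n * (3 * L₀) ^ d :=
    (Finset.card_biUnion_le_card_mul _ _ _ fun y _ => (card_cube L₀ y).le).trans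
      (Nat.mul_le_mul_right _ hcard₂)
  have htail := tail_bound hd hL hcardK hβ
  have hK : 2 * (((F₂.biUnion (cube L₀)).card : ℝ) *
        (2 * Real.exp (-γ ^ 2 / (2 * (varConst d C * ε ^ 2))))) ≤
      2 * (((F₂.biUnion (cube L₀)).card : ℝ) * (2 * Real.exp (-β ^ 2))) := by gcongr
  rw [hevent]
  linarith

end

end GFF

/-! ### Choice of the constants and of the intermediate level -/

theorem proposition2p2 (d : ℕ) (hd : 3 ≤ d) :
    ∃ c₁ c₂ : ℝ, 0 < c₁ ∧ 0 < c₂ ∧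
      ∀ P : MeasureTheory.Measure (GFF.Lat d → ℝ), GFF.IsGFF d P →
      ∀ (L₀ l₀ : ℕ), 1 ≤ L₀ → 100 ≤ l₀ →
      ∀ D : GFF.Lat d → Set (GFF.Config d),
        (∀ x ∈ GFF.renLat d L₀ l₀ 0,
          MeasurableSet[GFF.coordSigma (GFF.bigBox L₀ l₀ 0 x)] (D x)) →
        ((∀ x ∈ GFF.renLat d L₀ l₀ 0, IsUpperSet (D x)) →
          ∀ β h : ℕ → ℝ, (∀ n, 0 < β n) → Monotone h →
            GFF.BetaCondition c₂ d L₀ β →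
            GFF.LevelCondition c₁ d l₀ β h →
            ∀ n, GFF.q P L₀ l₀ D (n + 1) (h (n + 1)) ≤
              GFF.q P L₀ l₀ D n (h n) ^ 2 + 3 * Real.exp (-(β n - GFF.M c₂ d n L₀) ^ 2)) ∧
        ((∀ x ∈ GFF.renLat d L₀ l₀ 0, IsLowerSet (D x)) →
          ∀ β h : ℕ → ℝ, (∀ n, 0 < β n) → Antitone h →
            GFF.BetaCondition c₂ d L₀ β →
            GFF.LevelCondition c₁ d l₀ β (fun n => -h n) →
            ∀ n, GFF.q P L₀ l₀ D (n + 1) (h (n + 1)) ≤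
              GFF.q P L₀ l₀ D n (h n) ^ 2 + 3 * Real.exp (-(β n - GFF.M c₂ d n L₀) ^ 2)) := by
  obtain ⟨C, hC, hgreen⟩ := GFF.exists_green_le d hd
  have hd0 : (0 : ℝ) < d := by exact_mod_cast (by omega : 0 < d)
  have hv0 : 0 < GFF.varConst d C := by unfold GFF.varConst; positivity
  refine ⟨Real.sqrt (8 * GFF.varConst d C), Real.sqrt 2, by positivity, by positivity,
    fun P hP L₀ l₀ hL hl D hD => ⟨fun hup β h hβ0 _ hβ hlev n => ?_,
      fun hlow β h hβ0 _ hβ hlev n => ?_⟩⟩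
  -- Half of the level gap pays for each of the two passages, so `h'` is the midpoint.
  · refine hP.q_succ_le hd hC hgreen hL hl hD (γ := (h (n + 1) - h n) / 2)
      (h' := h (n + 1) - (h (n + 1) - h n) / 2) (hβ0 n) ?_ ?_ ?_ ?_
    · linarith [hβ n, Real.sqrt_nonneg (Real.log 2)]
    · linarith [hlev n]
    · exact fun T hT φ φ' hφ hA =>
        GFF.treeEvent_sub_of_isUpperSet (fun y hy => hup y (hT y hy)) hφ hA
    · intro T hT φ φ' hφ hA
      convert! GFF.treeEvent_sub_of_isUpperSet (fun y hy => hup y (hT y hy)) hφ hA using 2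
      ring
  · refine hP.q_succ_le hd hC hgreen hL hl hD (γ := (h n - h (n + 1)) / 2)
      (h' := h (n + 1) + (h n - h (n + 1)) / 2) (hβ0 n) ?_ ?_ ?_ ?_
    · linarith [hβ n, Real.sqrt_nonneg (Real.log 2)]
    · linarith [hlev n]
    · exact fun T hT φ φ' hφ hA =>
        GFF.treeEvent_add_of_isLowerSet (fun y hy => hlow y (hT y hy)) hφ hA
    · intro T hT φ φ' hφ hA
      convert! GFF.treeEvent_add_of_isLowerSet (fun y hy => hlow y (hT y hy)) hφ hA using 2
      ring
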